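/- Let $H_n=1+\frac12+\cdots+\frac1n$ (with $H_0=0$) and let $$F(x)=\sum_{n=0}^{\infty}(-1)^n\binom{2n}{n}^2H_n\,x^n ,\qquad \mathbf K(k)=\int_0^1\frac{dt}{\sqrt{(1-t^2)(1-k^2t^2)}} .$$ (i) For every real $x$ with $0<x<\frac1{16}$, the series $F(x)$ and the two integrals $\mathbf K$ below converge, and $$F(x)=\frac{1}{\pi\sqrt{1+16x}}\left[\ln\!\left(\frac{x}{1+16x}\right)\mathbf K\!\left(\sqrt{\frac{16x}{1+16x}}\right)+\pi\,\mathbf K\!\left(\frac{1}{\sqrt{1+16x}}\right)\right].\qquad(*)$$ (ii) More generally, the same convergence statements and the identity $(*)$ hold for every complex $x$ with $0<|x|<\frac1{16}$ (in particular for real $x$ with $-\frac1{16}<x<0$), where all square roots, including the one in the integrand of $\mathbf K$, and the logarithm are principal branches with argument in $(-\pi,\pi]$. (iii) At $x=0$ the series converges to $F(0)=0$, and $(*)$ holds in the limiting sense: its right-hand side tends to $F(0)=0$ as $x\to0$, $x\neq0$, $x \in \mathbb{C}$. -/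

import Mathlib

/-- The `n`-th term `(-1)^n * binom(2n, n)^2 * H_n * x^n`, with `H_n` the harmonic number. -/
noncomputable def harmonicTerm {𝕜 : Type*} [RCLike 𝕜] (x : 𝕜) (n : ℕ) : 𝕜 :=
  (-1) ^ n * (Nat.choose (2 * n) n : 𝕜) ^ 2 * ((harmonic n : ℚ) : 𝕜) * x ^ n

/-- The series `F(x) = ∑ (-1)^n binom(2n, n)^2 H_n x^n`, over the real or the complex numbers. -/
noncomputable def harmonicF {𝕜 : Type*} [RCLike 𝕜] (x : 𝕜) : 𝕜 :=
  ∑' n : ℕ, harmonicTerm x n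

/-- The integrand of the complete elliptic integral of the first kind, with real modulus `k`. -/
noncomputable def ellipticIntegrand (k t : ℝ) : ℝ :=
  1 / √((1 - t ^ 2) * (1 - k ^ 2 * t ^ 2))

/-- The complete elliptic integral of the first kind, with real modulus `k`. -/
noncomputable def ellipticK (k : ℝ) : ℝ :=
  ∫ t in (0 : ℝ)..1, ellipticIntegrand k t

/-- The integrand of the complete elliptic integral of the first kind, with complex modulus `k`
and the principal branch of the square root. -/
noncomputable def complexEllipticIntegrand (k : ℂ) (t : ℝ) : ℂ :=
  1 / Complex.sqrt ((1 - (t : ℂ) ^ 2) * (1 - k ^ 2 * (t : ℂ) ^ 2))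

/-- The complete elliptic integral of the first kind, with complex modulus `k`. -/
noncomputable def complexEllipticK (k : ℂ) : ℂ :=
  ∫ t in (0 : ℝ)..1, complexEllipticIntegrand k t

/-- The closed form, for real `x`. -/
noncomputable def closedForm (x : ℝ) : ℝ :=
  1 / (Real.pi * √(1 + 16 * x)) *
    (Real.log (x / (1 + 16 * x)) * ellipticK (√(16 * x / (1 + 16 * x)))
      + Real.pi * ellipticK (1 / √(1 + 16 * x)))

/-- The closed form, for complex `x`, with principal branches of the logarithm and the root. -/
noncomputable def complexClosedForm (x : ℂ) : ℂ :=
  1 / ((Real.pi : ℂ) * Complex.sqrt (1 + 16 * x)) *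
    (Complex.log (x / (1 + 16 * x)) * complexEllipticK (Complex.sqrt (16 * x / (1 + 16 * x)))
      + (Real.pi : ℂ) * complexEllipticK (1 / Complex.sqrt (1 + 16 * x)))

/-! Put y = 16x, A(y) = ∑ aₙyⁿ with aₙ = (-1)ⁿ(C(2n,n)/4ⁿ)², and G(y) = ∑ aₙHₙyⁿ, so that F(x) =
G(y). The substitution t = cos θ turns the two elliptic integrals into √(1+y) R(y) and √(1+y) S(y),
where R = ∫ (1 + y sin²θ)^(-1/2) and S = ∫ (sin²θ + y)^(-1/2) over [0, π/2]. The claim becomes R =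
(π/2) A (`regularIntegral_eq`) together with G = ½ log(y/(16(1+y))) A + S (`harmonicSum_eq`).

Let Df = (y(1+y)f')' + f/4. The recurrence for aₙ gives DA = 0, and an exact derivative in θ gives
DR = DS = 0 (`quarterIntegral_ode`). Since Hₙ₊₁ - Hₙ = 1/(n+1), DG = A'; since log(y/(1+y)) has
derivative 1/(y(1+y)), also D(½ log(y/(16(1+y))) A) = A'. Hence both differences to be shown zero
are solutions of Df = 0. They tend to 0 as y → 0⁺, for S because S = -½ log(y/16) + o(1)
(`tendsto_singularIntegral_add_log`). A solution independent of A grows logarithmically at 0, so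
both differences vanish near 0⁺ (`eventually_eq_zero_of_wronskian`).

Analytic continuation carries the identities to the unit disc, slit along (-1, 0] in the case of G.
On the slit itself the principal branches are continuous from above, so the identity for G passes to
the limit from the upper half plane. -/

/-! ### Differentiation under the integral sign. -/

theorem hasDerivAt_intervalIntegral_of_continuousOn {f f' : ℂ → ℝ → ℂ} {Ω : Set (ℂ × ℝ)}
    (hΩ : IsOpen Ω) {a b : ℝ} {y : ℂ} (hy : ∀ t ∈ Set.uIcc a b, (y, t) ∈ Ω)
    (hf : ContinuousOn (Function.uncurry f) Ω) (hf' : ContinuousOn (Function.uncurry f') Ω)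
    (hd : ∀ z t, (z, t) ∈ Ω → HasDerivAt (fun w => f w t) (f' z t) z) :
    HasDerivAt (fun z => ∫ t in a..b, f z t) (∫ t in a..b, f' y t) y := by
  -- By compactness Ω contains a closed ball around y times the whole interval; the maximum of the
  -- derivative there is a constant dominating function.
  obtain ⟨u, v, hu, hv, hyu, hv', huv⟩ := generalized_tube_lemma (isCompact_singleton (x := y))
    (isCompact_uIcc (a := a) (b := b)) hΩ (by rintro ⟨z, t⟩ ⟨rfl, ht⟩; exact hy t ht)
  obtain ⟨δ, hδ, hball⟩ := Metric.nhds_basis_closedBall.mem_iff.1 (hu.mem_nhds (hyu rfl))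
  have hsub : Metric.closedBall y δ ×ˢ Set.uIcc a b ⊆ Ω :=
    (Set.prod_mono hball hv').trans huv
  obtain ⟨C, hC⟩ := ((isCompact_closedBall y δ).prod isCompact_uIcc).exists_bound_of_continuousOn
    (hf'.mono hsub)
  have hcont : ∀ g : ℂ → ℝ → ℂ, ContinuousOn (Function.uncurry g) Ω →
      ∀ z ∈ Metric.closedBall y δ, ContinuousOn (g z) (Set.uIcc a b) := fun g hg z hz =>
    (hg.mono hsub).comp (f := fun t => (z, t)) (by fun_prop) fun t ht => ⟨hz, ht⟩
  have hyδ : y ∈ Metric.closedBall y δ := Metric.mem_closedBall_self hδ.le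
  refine (intervalIntegral.hasDerivAt_integral_of_dominated_loc_of_deriv_le
    (s := Metric.closedBall y δ) (bound := fun _ => C)
    (Metric.closedBall_mem_nhds y hδ) ?_ ?_ ?_ ?_ ?_ ?_).2
  · filter_upwards [Metric.closedBall_mem_nhds y hδ] with z hz
    exact (hcont f hf z hz).intervalIntegrable.def'.aestronglyMeasurable
  · exact (hcont f hf y hyδ).intervalIntegrable
  · exact (hcont f' hf' y hyδ).intervalIntegrable.def'.aestronglyMeasurable
  · exact .of_forall fun t ht z hz => hC (z, t) ⟨hz, Set.uIoc_subset_uIcc ht⟩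
  · exact intervalIntegrable_const
  · exact .of_forall fun t ht z hz => hd z t (hsub ⟨hz, Set.uIoc_subset_uIcc ht⟩)

theorem hasDerivAt_integral_mul_cpow {α β γ : ℝ → ℝ} (hα : Continuous α) (hβ : Continuous β)
    (hγ : Continuous γ) (e : ℂ) {a b : ℝ} {y : ℂ}
    (hy : ∀ t ∈ Set.uIcc a b, (α t + β t * y : ℂ) ∈ Complex.slitPlane) :
    HasDerivAt (fun z : ℂ => ∫ t in a..b, (γ t : ℂ) * (α t + β t * z : ℂ) ^ e)
      (∫ t in a..b, (γ t : ℂ) * (e * β t * (α t + β t * y : ℂ) ^ (e - 1))) y := by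
  have hc : Continuous fun p : ℂ × ℝ => (α p.2 + β p.2 * p.1 : ℂ) := by fun_prop
  refine hasDerivAt_intervalIntegral_of_continuousOn
    (Ω := {p : ℂ × ℝ | (α p.2 + β p.2 * p.1 : ℂ) ∈ Complex.slitPlane})
    (f := fun z t => (γ t : ℂ) * (α t + β t * z : ℂ) ^ e)
    (f' := fun y t => (γ t : ℂ) * (e * β t * (α t + β t * y : ℂ) ^ (e - 1)))
    (Complex.isOpen_slitPlane.preimage hc) hy ?_ ?_ ?_
  · exact (Continuous.continuousOn (by fun_prop)).mul
      (hc.continuousOn.cpow continuousOn_const fun p hp => hp)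
  · exact (Continuous.continuousOn (by fun_prop)).mul ((Continuous.continuousOn (by fun_prop)).mul
      (hc.continuousOn.cpow continuousOn_const fun p hp => hp))
  · intro z t hz
    have h1 : HasDerivAt (fun w : ℂ => (α t + β t * w : ℂ)) (β t) z := by
      simpa using ((hasDerivAt_id z).const_mul (β t : ℂ)).const_add (α t : ℂ)
    exact ((h1.cpow_const (c := e) hz).const_mul (γ t : ℂ)).congr_deriv (by ring)

/-! ### The differential equation of the two quarter-period integrals. -/

/-- The integral of `1 / √(α θ + β θ y)` over the quarter period. -/
noncomputable def quarterIntegral (α β : ℝ → ℝ) (y : ℂ) : ℂ :=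
  ∫ t in (0 : ℝ)..(Real.pi / 2), (α t + β t * y : ℂ) ^ (-1 / 2 : ℂ)

/-- With Q = α + βy, `hid` times Q^(-5/2) says that (y(1+y)f')' + f/4 for f = Q^(-1/2) equals ¼ d/dt
(sin t cos t Q^(-3/2)). The bracket vanishes at 0 and π/2, so its integral is 0. Leaving α and β
general covers both integrals at once. -/
theorem quarterIntegral_ode {α β α' β' : ℝ → ℝ} (hα : ∀ t, HasDerivAt α (α' t) t)
    (hβ : ∀ t, HasDerivAt β (β' t) t) (hα' : Continuous α') (hβ' : Continuous β')
    (hid : ∀ (t : ℝ) (y : ℂ), (1 + 2 * y) * (-1 / 2) * β t * (α t + β t * y)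
        + y * (1 + y) * (3 / 4) * β t ^ 2 + 1 / 4 * (α t + β t * y) ^ 2
      = 1 / 4 * ((Real.cos t ^ 2 - Real.sin t ^ 2) * (α t + β t * y)
        - 3 / 2 * (Real.sin t * Real.cos t) * (α' t + β' t * y)))
    {U : Set ℂ} (hU : ∀ y ∈ U, ∀ t ∈ Set.uIcc 0 (Real.pi / 2),
      (α t + β t * y : ℂ) ∈ Complex.slitPlane) :
    ∃ I' : ℂ → ℂ, ∀ y ∈ U, HasDerivAt (quarterIntegral α β) (I' y) y ∧
      HasDerivAt (fun z => z * (1 + z) * I' z) (-quarterIntegral α β y / 4) y := by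
  have cα : Continuous α := continuous_iff_continuousAt.2 fun t => (hα t).continuousAt
  have cβ : Continuous β := continuous_iff_continuousAt.2 fun t => (hβ t).continuousAt
  refine ⟨fun y => -1 / 2 * ∫ t in (0 : ℝ)..(Real.pi / 2),
    (β t : ℂ) * (α t + β t * y : ℂ) ^ (-3 / 2 : ℂ), fun y hy => ⟨?_, ?_⟩⟩
  · have h := hasDerivAt_integral_mul_cpow cα cβ (continuous_const (y := (1 : ℝ))) (-1 / 2 : ℂ)
      (hU y hy)
    simp only [Complex.ofReal_one, one_mul] at h
    refine HasDerivAt.congr_deriv h ?_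
    beta_reduce
    rw [← intervalIntegral.integral_const_mul]
    congr 1; ext t
    rw [show (-1 / 2 - 1 : ℂ) = -3 / 2 by norm_num]; ring
  · have h2 := (hasDerivAt_integral_mul_cpow cα cβ cβ (-3 / 2 : ℂ) (hU y hy)).const_mul (-1 / 2 : ℂ)
    have h3 : HasDerivAt (fun z : ℂ => z * (1 + z)) (1 + 2 * y) y :=
      ((hasDerivAt_id' y).mul ((hasDerivAt_id' y).const_add 1)).congr_deriv (by ring)
    refine (h3.mul h2).congr_deriv ?_
    set Q : ℝ → ℂ := fun t => α t + β t * y with hQ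
    have cQ : Continuous Q := by fun_prop
    have hQs : ∀ t ∈ Set.uIcc 0 (Real.pi / 2), Q t ∈ Complex.slitPlane := hU y hy
    have cpQ : ∀ e : ℂ, ContinuousOn (fun t => Q t ^ e) (Set.uIcc 0 (Real.pi / 2)) := fun e =>
      cQ.continuousOn.cpow continuousOn_const hQs
    have hderiv : ∀ t ∈ Set.uIcc 0 (Real.pi / 2), HasDerivAt
        (fun t : ℝ => (Real.sin t * Real.cos t : ℂ) * Q t ^ (-3 / 2 : ℂ))
        ((Real.cos t ^ 2 - Real.sin t ^ 2 : ℂ) * Q t ^ (-3 / 2 : ℂ) +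
          (Real.sin t * Real.cos t) * (-3 / 2 * (α' t + β' t * y) * Q t ^ (-5 / 2 : ℂ))) t := by
      intro t ht
      have hs := (Real.hasDerivAt_sin t).ofReal_comp
      have hc := (Real.hasDerivAt_cos t).ofReal_comp
      have hq : HasDerivAt Q (α' t + β' t * y) t :=
        (hα t).ofReal_comp.add ((hβ t).ofReal_comp.mul_const y)
      have hp := (HasDerivAt.cpow_const (c := (-3 / 2 : ℂ)) (hasDerivAt_id' (Q t))
        (hQs t ht)).comp t hq
      refine ((hs.mul hc).mul hp).congr_deriv ?_
      rw [show (-3 / 2 - 1 : ℂ) = -5 / 2 by norm_num]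
      simp only [Function.comp, Complex.ofReal_neg, Pi.mul_apply]
      ring
    have hint : ∫ t in (0 : ℝ)..(Real.pi / 2),
        ((Real.cos t ^ 2 - Real.sin t ^ 2 : ℂ) * Q t ^ (-3 / 2 : ℂ) +
          (Real.sin t * Real.cos t) * (-3 / 2 * (α' t + β' t * y) * Q t ^ (-5 / 2 : ℂ))) = 0 := by
      rw [intervalIntegral.integral_eq_sub_of_hasDerivAt hderiv]
      · simp
      · apply ContinuousOn.intervalIntegrable
        refine ContinuousOn.add (.mul (Continuous.continuousOn (by fun_prop)) (cpQ _))
          (.mul (Continuous.continuousOn (by fun_prop))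
            (.mul (Continuous.continuousOn (by fun_prop)) (cpQ _)))
    -- All powers of Q are expressed through Q^(-5/2), so that the integrand identity becomes the
    -- polynomial identity `hid`.
    have e1 : ∀ t ∈ Set.uIcc 0 (Real.pi / 2), Q t ^ (-1 / 2 : ℂ) = Q t ^ 2 * Q t ^ (-5 / 2 : ℂ) := by
      intro t ht
      rw [← Complex.cpow_natCast, ← Complex.cpow_add _ _ (Complex.slitPlane_ne_zero (hQs t ht))]
      norm_num
    have e2 : ∀ t ∈ Set.uIcc 0 (Real.pi / 2), Q t ^ (-3 / 2 : ℂ) = Q t * Q t ^ (-5 / 2 : ℂ) := by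
      intro t ht
      nth_rewrite 2 [← Complex.cpow_one (Q t)]
      rw [← Complex.cpow_add _ _ (Complex.slitPlane_ne_zero (hQs t ht))]
      norm_num
    have i1 : IntervalIntegrable (fun t => (β t : ℂ) * Q t ^ (-3 / 2 : ℂ)) MeasureTheory.volume 0
        (Real.pi / 2) := ContinuousOn.intervalIntegrable
      (.mul (Continuous.continuousOn (by fun_prop)) (cpQ _))
    have i2 : IntervalIntegrable (fun t => (β t : ℂ) * (-3 / 2 * β t * Q t ^ (-5 / 2 : ℂ)))
        MeasureTheory.volume 0 (Real.pi / 2) := ContinuousOn.intervalIntegrable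
      (.mul (Continuous.continuousOn (by fun_prop))
        (.mul (Continuous.continuousOn (by fun_prop)) (cpQ _)))
    have i3 : IntervalIntegrable (fun t => Q t ^ (-1 / 2 : ℂ)) MeasureTheory.volume 0
        (Real.pi / 2) := (cpQ _).intervalIntegrable
    rw [show (-3 / 2 - 1 : ℂ) = -5 / 2 by norm_num, quarterIntegral, ← sub_eq_zero]
    have hlin : (1 + 2 * y) * (-1 / 2)
          * (∫ t in (0 : ℝ)..(Real.pi / 2), (β t : ℂ) * Q t ^ (-3 / 2 : ℂ))
        + y * (1 + y) * (-1 / 2) * (∫ t in (0 : ℝ)..(Real.pi / 2),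
          (β t : ℂ) * (-3 / 2 * β t * Q t ^ (-5 / 2 : ℂ)))
        + 1 / 4 * (∫ t in (0 : ℝ)..(Real.pi / 2), Q t ^ (-1 / 2 : ℂ)) = 0 := by
      rw [← intervalIntegral.integral_const_mul, ← intervalIntegral.integral_const_mul,
        ← intervalIntegral.integral_const_mul, ← intervalIntegral.integral_add
          (i1.const_mul _) (i2.const_mul _), ← intervalIntegral.integral_add
          ((i1.const_mul _).add (i2.const_mul _)) (i3.const_mul _),
        ← mul_zero (1 / 4 : ℂ), ← hint, ← intervalIntegral.integral_const_mul]
      refine intervalIntegral.integral_congr fun t ht => ?_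
      rw [e1 t ht, e2 t ht]
      linear_combination Q t ^ (-5 / 2 : ℂ) * hid t y
    linear_combination hlin

/-- `∫ 1 / √(1 + y sin² θ)` over the quarter period. -/
noncomputable def regularIntegral (y : ℂ) : ℂ :=
  quarterIntegral (fun _ => 1) (fun t => Real.sin t ^ 2) y

/-- `∫ 1 / √(sin² θ + y)` over the quarter period. -/
noncomputable def singularIntegral (y : ℂ) : ℂ :=
  quarterIntegral (fun t => Real.sin t ^ 2) (fun _ => 1) y

theorem one_add_mul_mem_slitPlane {y : ℂ} (hy : ‖y‖ < 1) {r : ℝ} (h0 : 0 ≤ r) (h1 : r ≤ 1) :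
    1 + r * y ∈ Complex.slitPlane := by
  apply Complex.mem_slitPlane_of_norm_lt_one
  rw [norm_mul, Complex.norm_real, Real.norm_of_nonneg h0]
  nlinarith [norm_nonneg y]

theorem ofReal_add_mem_slitPlane {y : ℂ} (hy : y ∈ Complex.slitPlane) {r : ℝ} (h0 : 0 ≤ r) :
    r + y ∈ Complex.slitPlane := by
  rw [Complex.mem_slitPlane_iff] at *
  rcases hy with h | h
  · left; simp; linarith
  · right; simpa

theorem hasDerivAt_sin_sq (t : ℝ) :
    HasDerivAt (fun t => Real.sin t ^ 2) (2 * Real.sin t * Real.cos t) t := by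
  exact ((Real.hasDerivAt_sin t).pow 2).congr_deriv (by simp)

theorem regularIntegral_ode :
    ∃ I' : ℂ → ℂ, ∀ y ∈ Metric.ball (0 : ℂ) 1, HasDerivAt regularIntegral (I' y) y ∧
      HasDerivAt (fun z => z * (1 + z) * I' z) (-regularIntegral y / 4) y := by
  refine quarterIntegral_ode (α' := fun _ => 0) (fun t => hasDerivAt_const t 1) hasDerivAt_sin_sq
    continuous_const (by fun_prop) (fun t y => ?_) fun y hy t _ => ?_
  · have h : (Real.cos t : ℂ) ^ 2 = 1 - (Real.sin t : ℂ) ^ 2 := by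
      rw [eq_sub_iff_add_eq, add_comm]; exact_mod_cast Real.sin_sq_add_cos_sq t
    push_cast at h ⊢
    linear_combination (-1 / 4 + Complex.sin t ^ 2 * y / 2) * h
  · rw [Complex.ofReal_one]
    exact one_add_mul_mem_slitPlane (by simpa using hy) (by positivity) (Real.sin_sq_le_one t)

theorem singularIntegral_ode :
    ∃ I' : ℂ → ℂ, ∀ y ∈ Complex.slitPlane, HasDerivAt singularIntegral (I' y) y ∧
      HasDerivAt (fun z => z * (1 + z) * I' z) (-singularIntegral y / 4) y := by
  refine quarterIntegral_ode (β' := fun _ => 0) hasDerivAt_sin_sq (fun t => hasDerivAt_const t 1)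
    (by fun_prop) continuous_const (fun t y => ?_) fun y hy t _ => ?_
  · have h : (Real.cos t : ℂ) ^ 2 = 1 - (Real.sin t : ℂ) ^ 2 := by
      rw [eq_sub_iff_add_eq, add_comm]; exact_mod_cast Real.sin_sq_add_cos_sq t
    push_cast at h ⊢
    linear_combination (Complex.sin t ^ 2 / 2 - y / 4) * h
  · rw [Complex.ofReal_one, one_mul]
    exact ofReal_add_mem_slitPlane hy (by positivity)

/-! ### Power series with polynomially bounded coefficients. -/

/-- The sum of the power series with coefficients `c`. -/
noncomputable def powerSum (c : ℕ → ℂ) (y : ℂ) : ℂ := ∑' n, c n * y ^ n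

/-- The bound at n = 0 uses 0⁰ = 1: k = 0 permits c 0 = 1, while k ≥ 1 forces c 0 = 0. -/
theorem summable_mul_pow {c : ℕ → ℂ} {k : ℕ} (hc : ∀ n, ‖c n‖ ≤ (n : ℝ) ^ k) {y : ℂ}
    (hy : ‖y‖ < 1) : Summable fun n => c n * y ^ n := by
  refine Summable.of_norm_bounded (summable_pow_mul_geometric_of_norm_lt_one (R := ℝ) k
    (r := ‖y‖) (by simpa using hy)) fun n => ?_
  rw [norm_mul, norm_pow]
  exact mul_le_mul_of_nonneg_right (hc n) (by positivity)

theorem hasDerivAt_powerSum {c : ℕ → ℂ} {k : ℕ} (hc : ∀ n, ‖c n‖ ≤ (n : ℝ) ^ k) {y : ℂ}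
    (hy : ‖y‖ < 1) : HasDerivAt (powerSum c) (∑' n, c n * (n * y ^ (n - 1))) y := by
  obtain ⟨r, hyr, hr⟩ := exists_between hy
  have hr0 : 0 < r := (norm_nonneg y).trans_lt hyr
  have hu : Summable fun n : ℕ => (n : ℝ) ^ (k + 1) * r ^ n * r⁻¹ :=
    (summable_pow_mul_geometric_of_norm_lt_one (R := ℝ) (k + 1) (r := r)
      (by rwa [Real.norm_of_nonneg hr0.le])).mul_right _
  refine hasDerivAt_tsum_of_isPreconnected (t := Metric.ball 0 r) (y₀ := 0) hu Metric.isOpen_ball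
    (convex_ball _ _).isPreconnected (fun n z hz => (hasDerivAt_pow n z).const_mul (c n))
    (fun n z hz => ?_) (by simpa using hr0) ?_ (by simpa using hyr)
  · have hz' : ‖z‖ ≤ r := by simpa using (Metric.mem_ball.1 hz).le
    rcases n with _ | n
    · simp
    · simp only [norm_mul, norm_pow, Nat.add_sub_cancel, Complex.norm_natCast]
      calc ‖c (n + 1)‖ * (((n + 1 : ℕ) : ℝ) * ‖z‖ ^ n)
          ≤ ((n + 1 : ℕ) : ℝ) ^ k * (((n + 1 : ℕ) : ℝ) * r ^ n) := by
            gcongr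
            exact hc _
        _ = _ := by field_simp; ring
  · exact summable_mul_pow hc (by simp)

theorem hasDerivAt_powerSum_div {c : ℕ → ℂ} {k : ℕ} (hc : ∀ n, ‖c n‖ ≤ (n : ℝ) ^ k) {y : ℂ}
    (hy : ‖y‖ < 1) (h0 : y ≠ 0) :
    HasDerivAt (powerSum c) (powerSum (fun n => n * c n) y / y) y := by
  refine (hasDerivAt_powerSum hc hy).congr_deriv ?_
  rw [powerSum, ← tsum_div_const]
  refine tsum_congr fun n => ?_
  rcases n with _ | n
  · simp
  · simp only [Nat.add_sub_cancel]
    field_simp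
    ring

theorem powerSum_shift {c : ℕ → ℂ} {k : ℕ} (hc : ∀ n, ‖c n‖ ≤ (n : ℝ) ^ k) {y : ℂ}
    (hy : ‖y‖ < 1) : powerSum c y = c 0 + y * powerSum (fun n => c (n + 1)) y := by
  rw [powerSum, (summable_mul_pow hc hy).tsum_eq_zero_add, powerSum, ← tsum_mul_left]
  simp only [pow_zero, mul_one, pow_succ]
  congr 2; ext n; ring

/-! ### The two series and their differential equations. -/

/-- The coefficients `(-1)^n (centralBinom n / 4^n)^2`. -/
noncomputable def legendreCoeff (n : ℕ) : ℂ := (-1) ^ n * ((Nat.centralBinom n : ℂ) / 4 ^ n) ^ 2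

theorem legendreCoeff_succ (n : ℕ) :
    ((n : ℂ) + 1) ^ 2 * legendreCoeff (n + 1) = -(n + 1 / 2) ^ 2 * legendreCoeff n := by
  have h : ((n : ℂ) + 1) * Nat.centralBinom (n + 1) = 2 * (2 * n + 1) * Nat.centralBinom n := by
    exact_mod_cast Nat.succ_mul_centralBinom_succ n
  calc ((n : ℂ) + 1) ^ 2 * legendreCoeff (n + 1)
      = (-1) ^ (n + 1) * ((((n : ℂ) + 1) * Nat.centralBinom (n + 1)) / 4 ^ (n + 1)) ^ 2 := by
        rw [legendreCoeff]; ring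
    _ = _ := by rw [h, legendreCoeff]; ring

theorem norm_legendreCoeff_le (n : ℕ) : ‖legendreCoeff n‖ ≤ 1 := by
  have h : (Nat.centralBinom n : ℝ) ≤ 4 ^ n := by
    have := Nat.choose_le_two_pow (2 * n) n
    rw [pow_mul] at this
    exact_mod_cast this
  rw [legendreCoeff]
  simp only [norm_mul, norm_pow, norm_neg, norm_one, one_pow, one_mul, norm_div,
    Complex.norm_natCast, Complex.norm_ofNat]
  apply pow_le_one₀ (by positivity)
  exact div_le_one_of_le₀ h (by positivity)

theorem harmonic_nonneg (n : ℕ) : 0 ≤ harmonic n :=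
  Finset.sum_nonneg fun i _ => by positivity

theorem harmonic_le_self (n : ℕ) : harmonic n ≤ n := by
  induction n with
  | zero => simp
  | succ n ih =>
    rw [harmonic_succ]
    push_cast
    have : ((n : ℚ) + 1)⁻¹ ≤ 1 := inv_le_one_of_one_le₀ (by linarith [n.cast_nonneg (α := ℚ)])
    linarith

theorem norm_harmonic_le (n : ℕ) : ‖((harmonic n : ℚ) : ℂ)‖ ≤ n := by
  rw [Complex.norm_ratCast, abs_of_nonneg (by exact_mod_cast harmonic_nonneg n)]
  exact_mod_cast harmonic_le_self n

theorem norm_natCast_pow_mul_legendreCoeff_le (k n : ℕ) :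
    ‖(n : ℂ) ^ k * legendreCoeff n‖ ≤ (n : ℝ) ^ k := by
  rw [norm_mul, norm_pow, Complex.norm_natCast]
  exact mul_le_of_le_one_right (by positivity) (norm_legendreCoeff_le n)

theorem norm_natCast_pow_mul_legendreCoeff_harmonic_le (k n : ℕ) :
    ‖(n : ℂ) ^ k * (legendreCoeff n * (harmonic n : ℚ))‖ ≤ (n : ℝ) ^ (k + 1) := by
  rw [← mul_assoc, norm_mul, pow_succ]
  exact mul_le_mul (norm_natCast_pow_mul_legendreCoeff_le k n) (norm_harmonic_le n)
    (by positivity) (by positivity)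

/-- The power series `∑ (-1)^n (centralBinom n / 4^n)^2 y^n`. -/
noncomputable def legendreSum : ℂ → ℂ := powerSum legendreCoeff

/-- The power series `∑ (-1)^n (centralBinom n / 4^n)^2 H_n y^n`. -/
noncomputable def harmonicSum : ℂ → ℂ := powerSum fun n => legendreCoeff n * (harmonic n : ℚ)

/-- The operator `y (1 + y) d/dy` applied to `legendreSum`. -/
noncomputable def legendreSumDeriv (y : ℂ) : ℂ :=
  (1 + y) * powerSum (fun n => n * legendreCoeff n) y

/-- The operator `y (1 + y) d/dy` applied to `harmonicSum`. -/
noncomputable def harmonicSumDeriv (y : ℂ) : ℂ :=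
  (1 + y) * powerSum (fun n => n * (legendreCoeff n * (harmonic n : ℚ))) y

theorem one_add_ne_zero_of_norm_lt {y : ℂ} (hy : ‖y‖ < 1) : 1 + y ≠ 0 :=
  Complex.slitPlane_ne_zero (Complex.mem_slitPlane_of_norm_lt_one hy)

theorem hasDerivAt_legendreSum {y : ℂ} (hy : ‖y‖ < 1) (h0 : y ≠ 0) :
    HasDerivAt legendreSum (legendreSumDeriv y / (y * (1 + y))) y := by
  refine (hasDerivAt_powerSum_div (k := 0) (by simpa using norm_legendreCoeff_le) hy
    h0).congr_deriv ?_
  have := one_add_ne_zero_of_norm_lt hy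
  rw [legendreSumDeriv]
  field_simp

theorem hasDerivAt_harmonicSum {y : ℂ} (hy : ‖y‖ < 1) (h0 : y ≠ 0) :
    HasDerivAt harmonicSum (harmonicSumDeriv y / (y * (1 + y))) y := by
  refine (hasDerivAt_powerSum_div (k := 1)
    (by simpa using norm_natCast_pow_mul_legendreCoeff_harmonic_le 0) hy h0).congr_deriv ?_
  have := one_add_ne_zero_of_norm_lt hy
  rw [harmonicSumDeriv]
  field_simp

/-- With f = ∑ bₙyⁿ and θ = y d/dy, the left side is y((y(1+y)f')' + f/4) = (1+y)θ²f + yθf + yf/4.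
Its coefficient at yⁿ⁺¹ is (n+1)²bₙ₊₁ + (n² + n + ¼)bₙ, so the recurrence for b can be read off
directly. -/
theorem powerSum_linear_combination {b : ℕ → ℂ} {k : ℕ}
    (hb : ∀ j n : ℕ, ‖(n : ℂ) ^ j * b n‖ ≤ (n : ℝ) ^ (j + k)) {y : ℂ} (hy : ‖y‖ < 1) :
    (1 + y) * powerSum (fun n => (n : ℂ) ^ 2 * b n) y + y * powerSum (fun n => n * b n) y
        + y / 4 * powerSum b y
      = y * ∑' n : ℕ, (((n : ℂ) + 1) ^ 2 * b (n + 1) + (n + 1 / 2) ^ 2 * b n) * y ^ n := by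
  have s0 : Summable fun n => b n * y ^ n := summable_mul_pow (by simpa using hb 0) hy
  have s1 : Summable fun n : ℕ => (n * b n) * y ^ n := summable_mul_pow (by simpa using hb 1) hy
  have s2 : Summable fun n : ℕ => ((n : ℂ) ^ 2 * b n) * y ^ n := summable_mul_pow (hb 2) hy
  have s3 : Summable fun n : ℕ => (((n + 1 : ℕ) : ℂ) ^ 2 * b (n + 1)) * y ^ n := by
    rcases eq_or_ne y 0 with rfl | h0
    · exact summable_of_ne_finset_zero (s := {0}) fun n hn => by simp_all
    · refine (((summable_nat_add_iff 1).2 s2).mul_right y⁻¹).congr fun n => ?_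
      field_simp
      ring
  have e := powerSum_shift (hb 2) hy
  have : ∑' n : ℕ, (((n : ℂ) + 1) ^ 2 * b (n + 1) + (n + 1 / 2) ^ 2 * b n) * y ^ n
      = powerSum (fun n => ((n + 1 : ℕ) : ℂ) ^ 2 * b (n + 1)) y
        + (powerSum (fun n => (n : ℂ) ^ 2 * b n) y + powerSum (fun n => n * b n) y
          + 1 / 4 * powerSum b y) := by
    simp only [powerSum]
    rw [← tsum_mul_left, ← s2.tsum_add s1, ← (s2.add s1).tsum_add (s0.mul_left _),
      ← s3.tsum_add ((s2.add s1).add (s0.mul_left _))]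
    refine tsum_congr fun n => ?_
    push_cast
    ring
  rw [this, add_mul, one_mul]
  nth_rewrite 1 [e]
  simp
  ring

theorem hasDerivAt_legendreSumDeriv {y : ℂ} (hy : ‖y‖ < 1) (h0 : y ≠ 0) :
    HasDerivAt legendreSumDeriv (-legendreSum y / 4) y := by
  have h1 := ((hasDerivAt_id' y).const_add 1).mul (hasDerivAt_powerSum_div
    (c := fun n => n * legendreCoeff n) (k := 1)
    (by simpa using norm_natCast_pow_mul_legendreCoeff_le 1) hy h0)
  refine h1.congr_deriv ?_
  have h2 := powerSum_linear_combination (k := 0)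
    (by simpa using norm_natCast_pow_mul_legendreCoeff_le) hy
  have h3 : ∀ n : ℕ, ((n : ℂ) + 1) ^ 2 * legendreCoeff (n + 1) + (n + 1 / 2) ^ 2 * legendreCoeff n
      = 0 := fun n => by rw [legendreCoeff_succ]; ring
  simp only [h3, zero_mul, tsum_zero, mul_zero] at h2
  simp only [← mul_assoc, ← sq]
  rw [legendreSum]
  field_simp
  linear_combination 4 * h2

theorem hasDerivAt_harmonicSumDeriv {y : ℂ} (hy : ‖y‖ < 1) (h0 : y ≠ 0) :
    HasDerivAt harmonicSumDeriv
      (-harmonicSum y / 4 + legendreSumDeriv y / (y * (1 + y))) y := by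
  have h1 := ((hasDerivAt_id' y).const_add 1).mul (hasDerivAt_powerSum_div
    (c := fun n => n * (legendreCoeff n * (harmonic n : ℚ))) (k := 2)
    (by simpa using norm_natCast_pow_mul_legendreCoeff_harmonic_le 1) hy h0)
  refine h1.congr_deriv ?_
  have h2 := powerSum_linear_combination (k := 1)
    norm_natCast_pow_mul_legendreCoeff_harmonic_le hy
  -- The increment 1/(n+1) of the harmonic number leaves the defect (n+1)aₙ₊₁, the n-th coefficient
  -- of A'.
  have h3 : ∀ n : ℕ, ((n : ℂ) + 1) ^ 2 * (legendreCoeff (n + 1) * (harmonic (n + 1) : ℚ))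
      + (n + 1 / 2) ^ 2 * (legendreCoeff n * (harmonic n : ℚ))
      = ((n + 1 : ℕ) : ℂ) * legendreCoeff (n + 1) := fun n => by
    have : ((n : ℂ) + 1) ≠ 0 := by exact_mod_cast n.succ_ne_zero
    rw [harmonic_succ]
    push_cast
    rw [show ((n : ℂ) + 1) ^ 2 * (legendreCoeff (n + 1) * ((harmonic n : ℚ) + ((n : ℂ) + 1)⁻¹))
      = ((n : ℂ) + 1) ^ 2 * legendreCoeff (n + 1) * (harmonic n : ℚ)
        + (n + 1) * legendreCoeff (n + 1) by field_simp, legendreCoeff_succ]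
    ring
  have h4 := powerSum_shift (c := fun n => n * legendreCoeff n) (k := 1)
    (by simpa using norm_natCast_pow_mul_legendreCoeff_le 1) hy
  simp only [h3] at h2
  simp only [Nat.cast_zero, zero_mul, zero_add] at h4
  rw [← powerSum, ← h4] at h2
  have h5 := one_add_ne_zero_of_norm_lt hy
  have h6 : (fun n : ℕ => (n : ℂ) * (n * (legendreCoeff n * (harmonic n : ℚ))))
      = fun n : ℕ => (n : ℂ) ^ 2 * (legendreCoeff n * (harmonic n : ℚ)) := by ext; ring
  rw [h6, harmonicSum, legendreSumDeriv]
  generalize powerSum (fun n : ℕ => (n : ℂ) ^ 2 * (legendreCoeff n * (harmonic n : ℚ))) y = S₂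
    at h2 ⊢
  generalize powerSum (fun n : ℕ => (n : ℂ) * (legendreCoeff n * (harmonic n : ℚ))) y = S₁ at h2 ⊢
  field_simp
  linear_combination 4 * h2

theorem differentiableAt_legendreSum {y : ℂ} (hy : ‖y‖ < 1) : DifferentiableAt ℂ legendreSum y :=
  (hasDerivAt_powerSum (k := 0) (by simpa using norm_legendreCoeff_le) hy).differentiableAt

theorem differentiableAt_harmonicSum {y : ℂ} (hy : ‖y‖ < 1) : DifferentiableAt ℂ harmonicSum y :=
  (hasDerivAt_powerSum (k := 1)
    (by simpa using norm_natCast_pow_mul_legendreCoeff_harmonic_le 0) hy).differentiableAt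

theorem powerSum_zero (c : ℕ → ℂ) : powerSum c 0 = c 0 := by
  rw [powerSum, tsum_eq_single 0 fun n hn => by simp [hn]]
  simp

theorem legendreSum_zero : legendreSum 0 = 1 := by
  simp [legendreSum, powerSum_zero, legendreCoeff]

theorem harmonicSum_zero : harmonicSum 0 = 0 := by
  simp [harmonicSum, powerSum_zero]

/-! ### Uniqueness for the homogeneous equation at the singular point 0. -/

section

open Filter Topology Set

/-- The Wronskian C = wA - Wa is constant and (W/A)' = C/(y(1+y)A²) ~ C/y. Unless C = 0 this makes
W/A diverge like C log y, contradicting W/A → 0; with C = 0 the quotient is constant, hence 0. -/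
theorem eventually_eq_zero_of_wronskian {A a W w : ℝ → ℂ}
    (hA : ∀ y ∈ Ioo (0 : ℝ) 1, HasDerivAt A (a y / (y * (1 + y))) y)
    (ha : ∀ y ∈ Ioo (0 : ℝ) 1, HasDerivAt a (-A y / 4) y)
    (hW : ∀ y ∈ Ioo (0 : ℝ) 1, HasDerivAt W (w y / (y * (1 + y))) y)
    (hw : ∀ y ∈ Ioo (0 : ℝ) 1, HasDerivAt w (-W y / 4) y)
    (lA : Tendsto A (𝓝[>] 0) (𝓝 1)) (lW : Tendsto W (𝓝[>] 0) (𝓝 0)) :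
    ∀ᶠ y in 𝓝[>] (0 : ℝ), W y = 0 := by
  obtain ⟨C, hC⟩ : ∃ C, ∀ y ∈ Ioo (0 : ℝ) 1, w y * A y - W y * a y = C := by
    have hd : ∀ y ∈ Ioo (0 : ℝ) 1, HasDerivAt (fun y => w y * A y - W y * a y) 0 y := fun y hy =>
      (((hw y hy).mul (hA y hy)).sub ((hW y hy).mul (ha y hy))).congr_deriv (by ring)
    exact isOpen_Ioo.exists_is_const_of_deriv_eq_zero isPreconnected_Ioo
      (fun y hy => (hd y hy).differentiableAt.differentiableWithinAt) (fun y hy => (hd y hy).deriv)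
  obtain ⟨δ, hδ, hδA⟩ : ∃ δ ∈ Ioi (0 : ℝ), ∀ y ∈ Ioo 0 δ, A y ≠ 0 ∧ y < 1 := by
    have : ∀ᶠ y in 𝓝[>] (0 : ℝ), A y ≠ 0 ∧ y < 1 := (lA.eventually_ne one_ne_zero).and
      (mem_nhdsWithin_of_mem_nhds (Iio_mem_nhds one_pos))
    exact mem_nhdsGT_iff_exists_Ioo_subset.1 this
  have hg : ∀ y ∈ Ioo 0 δ, HasDerivAt (fun y => W y / A y) (C / (y * (1 + y) * A y ^ 2)) y := by
    intro y hy
    have hy1 : y ∈ Ioo (0 : ℝ) 1 := ⟨hy.1, (hδA y hy).2⟩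
    refine ((hW y hy1).div (hA y hy1) (hδA y hy).1).congr_deriv ?_
    rw [← hC y hy1]
    have := (hδA y hy).1
    have h1 : (y : ℂ) ≠ 0 := by exact_mod_cast hy.1.ne'
    have h2 : (1 + y : ℂ) ≠ 0 := by exact_mod_cast (by linarith [hy.1] : (1 + y : ℝ) ≠ 0)
    field_simp
  have lg : Tendsto (fun y => W y / A y) (𝓝[>] 0) (𝓝 0) := zero_div (1 : ℂ) ▸ lW.div lA one_ne_zero
  have hC0 : C = 0 := by
    have lk : Tendsto (fun y : ℝ => C / ((1 + y) * A y ^ 2) - C) (𝓝[>] 0) (𝓝 0) := by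
      have h1 : Tendsto (fun y : ℝ => (1 + y : ℂ)) (𝓝[>] 0) (𝓝 1) := by
        have : Continuous fun y : ℝ => (1 + y : ℂ) := by fun_prop
        simpa using (this.tendsto 0).mono_left nhdsWithin_le_nhds
      simpa using ((tendsto_const_nhds (x := C)).div (h1.mul (lA.pow 2)) (by simp)).sub_const C
    -- From y to 2y, C log t grows by C log 2 for every y, while W/A changes by o(1). The mean value
    -- inequality compares the two: the derivatives differ by at most ε/y on an interval of length
    -- y.
    have key : ∀ ε > 0, ‖C * Real.log 2‖ ≤ ε := by
      intro ε hε
      obtain ⟨η, hη, hηk⟩ := mem_nhdsGT_iff_exists_Ioo_subset.1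
        (lk.norm.eventually_le_const (by simpa using hε) :
          ∀ᶠ y in 𝓝[>] (0 : ℝ), ‖C / ((1 + y) * A y ^ 2) - C‖ ≤ ε)
      have hev : ∀ᶠ y in 𝓝[>] (0 : ℝ),
          ‖(W (2 * y) / A (2 * y) - W y / A y) - C * Real.log 2‖ ≤ ε := by
        have hm : 0 < min δ η / 2 := half_pos (lt_min hδ hη)
        filter_upwards [Ioo_mem_nhdsGT hm] with y hy
        have hy2 : 2 * y < min δ η := by linarith [hy.2]
        have hk : ∀ t ∈ Icc y (2 * y), HasDerivWithinAt (fun t => W t / A t - C * Real.log t)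
            (C / (t * (1 + t) * A t ^ 2) - C * (t⁻¹ : ℝ)) (Icc y (2 * y)) t := by
          intro t ht
          have ht0 : 0 < t := hy.1.trans_le ht.1
          have htδ : t < δ := (ht.2.trans_lt hy2).trans_le (min_le_left _ _)
          exact ((hg t ⟨ht0, htδ⟩).sub
            ((Real.hasDerivAt_log ht0.ne').ofReal_comp.const_mul C)).hasDerivWithinAt
        have hb : ∀ t ∈ Icc y (2 * y), ‖C / (t * (1 + t) * A t ^ 2) - C * (t⁻¹ : ℝ)‖ ≤ ε / y := by
          intro t ht
          have ht0 : 0 < t := hy.1.trans_le ht.1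
          have hη' : ‖C / ((1 + t) * A t ^ 2) - C‖ ≤ ε :=
            hηk ⟨ht0, (ht.2.trans_lt hy2).trans_le (min_le_right _ _)⟩
          have h1 : (t : ℂ) ≠ 0 := by exact_mod_cast ht0.ne'
          have : C / (t * (1 + t) * A t ^ 2) - C * (t⁻¹ : ℝ)
              = (C / ((1 + t) * A t ^ 2) - C) / t := by
            push_cast
            rw [sub_div, div_div, div_eq_mul_inv C (t : ℂ)]
            congr 2; ring
          rw [this, norm_div, Complex.norm_real, Real.norm_of_nonneg ht0.le]
          exact div_le_div₀ hε.le hη' hy.1 ht.1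
        have := (convex_Icc y (2 * y)).norm_image_sub_le_of_norm_hasDerivWithin_le hk hb
          (left_mem_Icc.2 (by linarith [hy.1])) (right_mem_Icc.2 (by linarith [hy.1]))
        rw [Real.log_mul two_ne_zero hy.1.ne', show 2 * y - y = y by ring,
          Real.norm_of_nonneg hy.1.le, div_mul_cancel₀ _ hy.1.ne'] at this
        refine (congrArg norm ?_).trans_le this
        push_cast; ring
      have h2 : Tendsto (fun y : ℝ => 2 * y) (𝓝[>] 0) (𝓝[>] 0) := by
        refine tendsto_nhdsWithin_of_tendsto_nhds_of_eventually_within _ ?_ ?_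
        · have : Continuous fun y : ℝ => 2 * y := by fun_prop
          simpa using (this.tendsto 0).mono_left nhdsWithin_le_nhds
        · filter_upwards [self_mem_nhdsWithin] with y hy
          exact mul_pos two_pos (mem_Ioi.1 hy)
      have hlim := (((lg.comp h2).sub lg).sub_const (C * Real.log 2)).norm
      have := le_of_tendsto hlim hev
      simpa using this
    have := norm_le_zero_iff.1 (le_of_forall_pos_le_add fun ε hε =>
      (key ε hε).trans_eq (zero_add ε).symm)
    rcases mul_eq_zero.1 this with h | h
    · exact h
    · exact absurd (by exact_mod_cast h) (Real.log_pos one_lt_two).ne'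
  obtain ⟨D, hD⟩ : ∃ D, ∀ y ∈ Ioo 0 δ, W y / A y = D :=
    isOpen_Ioo.exists_is_const_of_deriv_eq_zero isPreconnected_Ioo
      (fun y hy => (hg y hy).differentiableAt.differentiableWithinAt)
      (fun y hy => by simpa [hC0] using (hg y hy).deriv)
  have hD0 : D = 0 := by
    refine tendsto_nhds_unique (tendsto_const_nhds.congr' ?_) lg
    filter_upwards [Ioo_mem_nhdsGT hδ] with y hy using (hD y hy).symm
  filter_upwards [Ioo_mem_nhdsGT hδ] with y hy
  have := hD y hy
  rw [hD0, div_eq_zero_iff] at this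
  exact this.resolve_right (hδA y hy).1

/-! ### Asymptotics of the singular integral at 0⁺. -/

/-- The numerator 1 of S is split as cos t + (1 - cos t). The cosine part is elementary and carries
the whole logarithm; the other part stays bounded. -/
theorem integral_cos_div_sqrt {y : ℝ} (hy : 0 < y) :
    ∫ t in (0 : ℝ)..(Real.pi / 2), Real.cos t / √(Real.sin t ^ 2 + y) = Real.arsinh (√y)⁻¹ := by
  have hd : ∀ t ∈ uIcc 0 (Real.pi / 2), HasDerivAt (fun t => Real.arsinh (Real.sin t / √y))
      (Real.cos t / √(Real.sin t ^ 2 + y)) t := fun t _ => by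
    refine ((Real.hasDerivAt_sin t).div_const (√y)).arsinh.congr_deriv ?_
    have h1 : √(1 + (Real.sin t / √y) ^ 2) = √(Real.sin t ^ 2 + y) / √y := by
      rw [← Real.sqrt_div (by positivity), div_pow, Real.sq_sqrt hy.le]
      congr 1
      field_simp
      ring
    have h2 : 0 < √y := Real.sqrt_pos.2 hy
    have h3 : 0 < √(Real.sin t ^ 2 + y) := Real.sqrt_pos.2 (by positivity)
    rw [h1, smul_eq_mul]
    field_simp
  rw [intervalIntegral.integral_eq_sub_of_hasDerivAt hd]
  · simp
  · refine (Continuous.div (by fun_prop) (by fun_prop) fun t => ?_).intervalIntegrable _ _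
    exact (Real.sqrt_pos.2 (by positivity)).ne'

theorem tendsto_arsinh_inv_sqrt_add_log :
    Tendsto (fun y : ℝ => Real.arsinh (√y)⁻¹ + 1 / 2 * Real.log y) (𝓝[>] 0) (𝓝 (Real.log 2)) := by
  have h : Tendsto (fun y : ℝ => Real.log (1 + √(y + 1))) (𝓝[>] 0) (𝓝 (Real.log 2)) := by
    have : ContinuousAt (fun y : ℝ => Real.log (1 + √(y + 1))) 0 :=
      ContinuousAt.log (by fun_prop) (by positivity)
    have h2 := this.tendsto.mono_left (nhdsWithin_le_nhds (s := Ioi 0))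
    norm_num at h2
    exact h2
  refine h.congr' ?_
  filter_upwards [self_mem_nhdsWithin] with y hy
  have hy : 0 < y := hy
  have h2 : 0 < √y := Real.sqrt_pos.2 hy
  have h1 : √(1 + (√y)⁻¹ ^ 2) = √(y + 1) / √y := by
    rw [← Real.sqrt_div (by positivity), inv_pow, Real.sq_sqrt hy.le]
    congr 1
    field_simp
  rw [Real.arsinh, h1, inv_eq_one_div, ← add_div, Real.log_div (by positivity) h2.ne',
    Real.log_sqrt hy.le]
  ring

theorem integral_tan_half :
    ∫ t in (0 : ℝ)..(Real.pi / 2), (1 - Real.cos t) / Real.sin t = Real.log 2 := by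
  have hpos : ∀ t ∈ uIcc 0 (Real.pi / 2), 0 < Real.cos (t / 2) := fun t ht => by
    rw [uIcc_of_le (by positivity)] at ht
    exact Real.cos_pos_of_mem_Ioo ⟨by linarith [ht.1, Real.pi_pos], by linarith [ht.2, Real.pi_pos]⟩
  have hd : ∀ t ∈ uIcc 0 (Real.pi / 2), HasDerivAt (fun t => -2 * Real.log (Real.cos (t / 2)))
      (Real.sin (t / 2) / Real.cos (t / 2)) t := fun t ht => by
    exact ((((hasDerivAt_id' t).div_const 2).cos.log (hpos t ht).ne').const_mul (-2)).congr_deriv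
      (by ring)
  have he : ∀ t ∈ uIcc 0 (Real.pi / 2), (1 - Real.cos t) / Real.sin t
      = Real.sin (t / 2) / Real.cos (t / 2) := fun t ht => by
    have h1 : Real.cos t = 1 - 2 * Real.sin (t / 2) ^ 2 := by
      rw [← mul_div_cancel₀ t two_ne_zero, Real.cos_two_mul, Real.cos_sq']; ring_nf
    have h2 : Real.sin t = 2 * Real.sin (t / 2) * Real.cos (t / 2) := by
      rw [← Real.sin_two_mul]; ring_nf
    have h3 := (hpos t ht).ne'
    rw [h1, h2]
    -- At t = 0 the left quotient is 0/0, whose value 0 agrees with tan 0.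
    rcases eq_or_ne (Real.sin (t / 2)) 0 with h0 | h0
    · simp [h0]
    · field_simp; ring
  rw [intervalIntegral.integral_congr he, intervalIntegral.integral_eq_sub_of_hasDerivAt hd]
  · rw [div_div, show (2 * 2 : ℝ) = 4 by norm_num, Real.cos_pi_div_four,
      Real.log_div (by positivity) two_ne_zero, Real.log_sqrt (by norm_num)]
    simp; ring
  · exact (ContinuousOn.div (by fun_prop) (by fun_prop) fun t ht => (hpos t ht).ne').intervalIntegrable

theorem tendsto_integral_one_sub_cos_div_sqrt :
    Tendsto (fun y : ℝ => ∫ t in (0 : ℝ)..(Real.pi / 2), (1 - Real.cos t) / √(Real.sin t ^ 2 + y))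
      (𝓝[>] 0) (𝓝 (Real.log 2)) := by
  rw [← integral_tan_half]
  have hsin : ∀ t ∈ uIoc 0 (Real.pi / 2), 0 < Real.sin t ∧ 0 ≤ Real.cos t := fun t ht => by
    rw [uIoc_of_le (by positivity)] at ht
    exact ⟨Real.sin_pos_of_pos_of_lt_pi ht.1 (by linarith [ht.2, Real.pi_pos]),
      Real.cos_nonneg_of_mem_Icc ⟨by linarith [ht.1, Real.pi_pos], ht.2⟩⟩
  refine intervalIntegral.tendsto_integral_filter_of_dominated_convergence (fun _ => 1) ?_ ?_ ?_ ?_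
  · filter_upwards [self_mem_nhdsWithin] with y hy
    have hy : 0 < y := hy
    refine (Continuous.div (by fun_prop) (by fun_prop) fun t => ?_).aestronglyMeasurable
    exact (Real.sqrt_pos.2 (by positivity)).ne'
  · filter_upwards [self_mem_nhdsWithin] with y hy
    have hy : 0 < y := hy
    refine .of_forall fun t ht => ?_
    obtain ⟨h1, h2⟩ := hsin t ht
    rw [Real.norm_of_nonneg (div_nonneg (by linarith [Real.cos_le_one t]) (Real.sqrt_nonneg _))]
    refine div_le_one_of_le₀ (Real.le_sqrt_of_sq_le ?_) (Real.sqrt_nonneg _)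
    -- For cos t ≥ 0, (1 - cos t)² ≤ (1 - cos t)(1 + cos t) = sin² t, hence the dominating function
    -- 1.
    nlinarith [Real.sin_sq_add_cos_sq t, Real.cos_le_one t]
  · exact intervalIntegrable_const
  · refine .of_forall fun t ht => ?_
    obtain ⟨h1, h2⟩ := hsin t ht
    have h3 : ContinuousAt (fun y : ℝ => (1 - Real.cos t) / √(Real.sin t ^ 2 + y)) 0 :=
      ContinuousAt.div (by fun_prop) (by fun_prop) (Real.sqrt_pos.2 (by positivity)).ne'
    have h4 := h3.tendsto.mono_left (nhdsWithin_le_nhds (s := Ioi 0))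
    rwa [add_zero, Real.sqrt_sq h1.le] at h4

theorem ofReal_cpow_neg_half {r : ℝ} (hr : 0 ≤ r) : (r : ℂ) ^ (-1 / 2 : ℂ) = ((√r)⁻¹ : ℝ) := by
  rw [Real.sqrt_eq_rpow, ← Real.rpow_neg hr, Complex.ofReal_cpow hr]
  norm_num

theorem singularIntegral_ofReal {y : ℝ} (hy : 0 < y) :
    singularIntegral y = ((Real.arsinh (√y)⁻¹
      + ∫ t in (0 : ℝ)..(Real.pi / 2), (1 - Real.cos t) / √(Real.sin t ^ 2 + y) : ℝ) : ℂ) := by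
  have hc : ∀ f : ℝ → ℝ, Continuous f → IntervalIntegrable
      (fun t => f t / √(Real.sin t ^ 2 + y)) MeasureTheory.volume 0 (Real.pi / 2) := fun f hf =>
    (hf.div (by fun_prop) fun t => (Real.sqrt_pos.2 (by positivity)).ne').intervalIntegrable _ _
  rw [← integral_cos_div_sqrt hy, ← intervalIntegral.integral_add (hc _ (by fun_prop))
    (hc _ (by fun_prop)), ← intervalIntegral.integral_ofReal, singularIntegral, quarterIntegral]
  congr 1; ext t
  have h := ofReal_cpow_neg_half (r := Real.sin t ^ 2 + y) (by positivity)
  rw [← add_div, add_sub_cancel, one_div, ← h]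
  push_cast
  rw [one_mul]

/-- Each part of the split contributes log 2, and 2 log 2 = ½ log 16 is the source of the 16. -/
theorem tendsto_singularIntegral_add_log :
    Tendsto (fun y : ℝ => singularIntegral y + 1 / 2 * (Real.log (y / 16) : ℝ)) (𝓝[>] 0) (𝓝 0) := by
  have h := (tendsto_arsinh_inv_sqrt_add_log.add
    tendsto_integral_one_sub_cos_div_sqrt).sub_const (2 * Real.log 2)
  have h2 := (Complex.continuous_ofReal.tendsto _).comp h
  rw [show Real.log 2 + Real.log 2 - 2 * Real.log 2 = 0 by ring, Complex.ofReal_zero] at h2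
  refine h2.congr' ?_
  filter_upwards [self_mem_nhdsWithin] with y hy
  have hy : 0 < y := hy
  have h16 : Real.log 16 = 4 * Real.log 2 := by
    rw [show (16 : ℝ) = 2 ^ 4 by norm_num, Real.log_pow]; norm_num
  rw [singularIntegral_ofReal hy, Real.log_div hy.ne' (by norm_num), h16]
  simp only [Function.comp]
  push_cast
  ring

/-! ### Analytic continuation from small positive reals. -/

/-- The identity theorem is applied at an interior point r > 0 of the interval of coincidence,
because 0 is only a boundary point of the slit disc. -/
theorem eqOn_of_eventually_ofReal_eq {f g : ℂ → ℂ} {U : Set ℂ} (hU : IsOpen U)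
    (hc : IsPreconnected U) (hr : ∀ r ∈ Ioo (0 : ℝ) 1, (r : ℂ) ∈ U)
    (hf : DifferentiableOn ℂ f U) (hg : DifferentiableOn ℂ g U)
    (h : ∀ᶠ r : ℝ in 𝓝[>] 0, f r = g r) : EqOn f g U := by
  obtain ⟨δ, hδ, hδ'⟩ := mem_nhdsGT_iff_exists_Ioo_subset.1
    (h.and (Ioo_mem_nhdsGT one_pos : ∀ᶠ r : ℝ in 𝓝[>] 0, r ∈ Ioo (0 : ℝ) 1))
  have hδ : 0 < δ := hδ
  obtain ⟨r, hr0, hrδ⟩ := exists_between hδ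
  refine (hf.analyticOnNhd hU).eqOn_of_preconnected_of_frequently_eq (hg.analyticOnNhd hU) hc
    (hr r (hδ' ⟨hr0, hrδ⟩).2) ?_
  have ht : Tendsto (fun r : ℝ => (r : ℂ)) (𝓝[≠] r) (𝓝[≠] (r : ℂ)) :=
    Complex.continuous_ofReal.continuousAt.continuousWithinAt.tendsto_nhdsWithin
      fun s hs => by simpa using hs
  refine ht.frequently (Eventually.frequently ?_)
  filter_upwards [mem_nhdsWithin_of_mem_nhds (Ioo_mem_nhds hr0 hrδ)] with s hs using (hδ' hs).1

theorem norm_ofReal_lt_one {r : ℝ} (hr : r ∈ Ioo (0 : ℝ) 1) : ‖(r : ℂ)‖ < 1 := by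
  rw [Complex.norm_real, Real.norm_of_nonneg hr.1.le]; exact hr.2

theorem ofReal_ne_zero_of_mem_Ioo {r : ℝ} (hr : r ∈ Ioo (0 : ℝ) 1) : (r : ℂ) ≠ 0 := by
  exact_mod_cast hr.1.ne'

theorem one_add_ofReal_ne_zero {r : ℝ} (hr : r ∈ Ioo (0 : ℝ) 1) : (1 + r : ℂ) ≠ 0 :=
  one_add_ne_zero_of_norm_lt (norm_ofReal_lt_one hr)

theorem tendsto_ofReal_of_continuousAt {f : ℂ → ℂ} (hf : ContinuousAt f 0) :
    Tendsto (fun r : ℝ => f r) (𝓝[>] 0) (𝓝 (f 0)) := by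
  have : ContinuousAt (fun r : ℝ => f r) 0 :=
    ContinuousAt.comp (f := fun r : ℝ => (r : ℂ)) (by simpa using hf) (by fun_prop)
  simpa using this.tendsto.mono_left (nhdsWithin_le_nhds (s := Ioi 0))

theorem eventually_eq_zero_of_legendre_ode {W w : ℝ → ℂ}
    (hW : ∀ y ∈ Ioo (0 : ℝ) 1, HasDerivAt W (w y / (y * (1 + y))) y)
    (hw : ∀ y ∈ Ioo (0 : ℝ) 1, HasDerivAt w (-W y / 4) y)
    (lW : Tendsto W (𝓝[>] 0) (𝓝 0)) : ∀ᶠ y in 𝓝[>] (0 : ℝ), W y = 0 := by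
  refine eventually_eq_zero_of_wronskian (A := fun r => legendreSum r)
    (a := fun r => legendreSumDeriv r) (fun y hy => ?_) (fun y hy => ?_) hW hw ?_ lW
  · exact (hasDerivAt_legendreSum (norm_ofReal_lt_one hy) (ofReal_ne_zero_of_mem_Ioo hy)).comp_ofReal
  · exact (hasDerivAt_legendreSumDeriv (norm_ofReal_lt_one hy)
      (ofReal_ne_zero_of_mem_Ioo hy)).comp_ofReal
  · rw [← legendreSum_zero]
    exact tendsto_ofReal_of_continuousAt (differentiableAt_legendreSum (by simp)).continuousAt

theorem regularIntegral_zero : regularIntegral 0 = Real.pi / 2 := by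
  simp [regularIntegral, quarterIntegral]

theorem regularIntegral_eq {y : ℂ} (hy : ‖y‖ < 1) :
    regularIntegral y = Real.pi / 2 * legendreSum y := by
  obtain ⟨I', hI⟩ := regularIntegral_ode
  have hb : ∀ r ∈ Ioo (0 : ℝ) 1, (r : ℂ) ∈ Metric.ball (0 : ℂ) 1 := fun r hr => by
    simpa using norm_ofReal_lt_one hr
  refine eqOn_of_eventually_ofReal_eq Metric.isOpen_ball (convex_ball (0 : ℂ) 1).isPreconnected hb
    (fun z hz => (hI z hz).1.differentiableAt.differentiableWithinAt)
    (g := fun y => Real.pi / 2 * legendreSum y) (fun z hz => ((differentiableAt_legendreSum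
      (by simpa using hz)).const_mul _).differentiableWithinAt) ?_ (by simpa using hy)
  have := eventually_eq_zero_of_legendre_ode
    (W := fun r => regularIntegral r - Real.pi / 2 * legendreSum r)
    (w := fun r => r * (1 + r) * I' r - Real.pi / 2 * legendreSumDeriv r)
    (fun y hy => ?_) (fun y hy => ?_) ?_
  · filter_upwards [this] with r hr using sub_eq_zero.1 hr
  · have h0 := ofReal_ne_zero_of_mem_Ioo hy
    have h1 := one_add_ofReal_ne_zero hy
    refine ((hI y (hb y hy)).1.sub ((hasDerivAt_legendreSum (norm_ofReal_lt_one hy)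
      h0).const_mul (Real.pi / 2 : ℂ))).comp_ofReal.congr_deriv ?_
    field_simp
  · refine ((hI y (hb y hy)).2.sub ((hasDerivAt_legendreSumDeriv (norm_ofReal_lt_one hy)
      (ofReal_ne_zero_of_mem_Ioo hy)).const_mul (Real.pi / 2 : ℂ))).comp_ofReal.congr_deriv ?_
    ring
  · have h : ContinuousAt (fun y : ℂ => regularIntegral y - Real.pi / 2 * legendreSum y) 0 :=
      (hI 0 (by simp)).1.continuousAt.sub
        ((differentiableAt_legendreSum (by simp)).continuousAt.const_mul _)
    simpa [regularIntegral_zero, legendreSum_zero] using tendsto_ofReal_of_continuousAt h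

/-- A(r) - 1 = O(r) and r log r → 0. This allows log(r/16) A(r) to be replaced by log(r/16), which
cancels against S. -/
theorem tendsto_log_mul_sub_one :
    Tendsto (fun r : ℝ => (Real.log (r / 16) : ℂ) * (legendreSum r - 1)) (𝓝[>] 0) (𝓝 0) := by
  obtain ⟨C, hC⟩ := (differentiableAt_legendreSum (y := 0) (by simp)).hasDerivAt.isBigO_sub.bound
  have h1 : ∀ᶠ r : ℝ in 𝓝[>] 0, ‖(legendreSum r - 1 : ℂ)‖ ≤ C * r := by
    have ht : Tendsto (fun r : ℝ => (r : ℂ)) (𝓝[>] 0) (𝓝 0) := by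
      simpa using tendsto_ofReal_of_continuousAt (f := id) continuousAt_id
    filter_upwards [ht.eventually hC, self_mem_nhdsWithin] with r hr hr0
    rw [legendreSum_zero, sub_zero, Complex.norm_real, Real.norm_of_nonneg (le_of_lt hr0)] at hr
    exact hr
  have h2 : Tendsto (fun r : ℝ => C * ‖r * Real.log (r / 16)‖) (𝓝[>] 0) (𝓝 0) := by
    have h3 : Continuous fun r : ℝ => 16 * (r / 16 * Real.log (r / 16)) :=
      continuous_const.mul (Real.continuous_mul_log.comp (continuous_id.div_const 16))
    have h4 : Continuous fun r : ℝ => C * ‖16 * (r / 16 * Real.log (r / 16))‖ :=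
      continuous_const.mul h3.norm
    have := (h4.tendsto 0).mono_left (nhdsWithin_le_nhds (s := Ioi 0))
    simp only [zero_div, zero_mul, mul_zero, norm_zero] at this
    refine this.congr fun r => ?_
    congr 2; ring
  refine squeeze_zero_norm' ?_ h2
  filter_upwards [h1, self_mem_nhdsWithin] with r hr hr0
  rw [norm_mul, Complex.norm_real, norm_mul, Real.norm_of_nonneg (le_of_lt hr0)]
  nlinarith [mul_le_mul_of_nonneg_left hr (norm_nonneg (Real.log (r / 16)))]

/-- The unit disc, slit along the nonpositive real axis. -/
def slitDisc : Set ℂ := Metric.ball 0 1 ∩ Complex.slitPlane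

theorem isOpen_slitDisc : IsOpen slitDisc := Metric.isOpen_ball.inter Complex.isOpen_slitPlane

theorem isPreconnected_slitDisc : IsPreconnected slitDisc := by
  -- Disc and slit plane are both star-shaped about any positive real point of the disc; 1/2 is one
  -- choice.
  have h : StarConvex ℝ ((1 / 2 : ℝ) : ℂ) slitDisc :=
    ((convex_ball (0 : ℂ) 1).starConvex (by simp; norm_num)).inter
      (Complex.starConvex_ofReal_slitPlane (by norm_num))
  exact (h.isPathConnected ⟨by simp; norm_num,
    Complex.ofReal_mem_slitPlane.2 (by norm_num)⟩).isConnected.isPreconnected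

theorem div_one_add_im (y : ℂ) : (y / (1 + y)).im = y.im / Complex.normSq (1 + y) := by
  rw [Complex.div_im]
  simp only [Complex.add_re, Complex.add_im, Complex.one_re, Complex.one_im]
  ring

/-- The map y ↦ y/(1+y) preserves the sign of the imaginary part, and on the real points of the slit
disc it preserves positivity. Hence the logarithm in the closed form is analytic there. -/
theorem div_one_add_mem_slitPlane {y : ℂ} (hy : y ∈ slitDisc) :
    y / (1 + y) ∈ Complex.slitPlane := by
  have hn : ‖y‖ < 1 := by simpa using hy.1
  have h1 := one_add_ne_zero_of_norm_lt hn
  have hN := Complex.normSq_pos.2 h1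
  rw [Complex.mem_slitPlane_iff]
  by_cases h : y.im = 0
  · left
    have h0 : 0 < y.re := (Complex.mem_slitPlane_iff.1 hy.2).resolve_right (by simpa using h)
    rw [Complex.div_re]
    simp only [Complex.add_re, Complex.add_im, Complex.one_re, Complex.one_im, h]
    have : 0 < y.re * (1 + y.re) / Complex.normSq (1 + y) := by positivity
    simpa using this
  · right
    rw [div_one_add_im]
    exact div_ne_zero h hN.ne'

theorem harmonicSum_eq_of_mem_slitDisc {y : ℂ} (hy : y ∈ slitDisc) :
    harmonicSum y
      = 1 / 2 * Complex.log (y / (1 + y) / 16) * legendreSum y + singularIntegral y := by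
  obtain ⟨I', hI⟩ := singularIntegral_ode
  have hb : ∀ r ∈ Ioo (0 : ℝ) 1, (r : ℂ) ∈ slitDisc := fun r hr =>
    ⟨by simpa using norm_ofReal_lt_one hr, Complex.ofReal_mem_slitPlane.2 hr.1⟩
  have hn : ∀ z ∈ slitDisc, ‖z‖ < 1 := fun z hz => by simpa using hz.1
  have hslit : ∀ z ∈ slitDisc, z / (1 + z) / 16 ∈ Complex.slitPlane := fun z hz => by
    rw [div_eq_inv_mul _ (16 : ℂ)]
    have h := div_one_add_mem_slitPlane hz
    rw [Complex.mem_slitPlane_iff] at h ⊢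
    rw [show ((16 : ℂ)⁻¹) = ((16⁻¹ : ℝ) : ℂ) by push_cast; rfl, Complex.re_ofReal_mul,
      Complex.im_ofReal_mul]
    exact h.imp (fun h => by positivity) fun h => mul_ne_zero (by norm_num) h
  have hlog : ∀ z ∈ slitDisc, HasDerivAt (fun z => Complex.log (z / (1 + z) / 16))
      (1 / (z * (1 + z))) z := fun z hz => by
    have h0 := Complex.slitPlane_ne_zero hz.2
    have h1 := one_add_ne_zero_of_norm_lt (hn z hz)
    refine ((((hasDerivAt_id' z).div ((hasDerivAt_id' z).const_add 1) h1).div_const 16).clog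
      (hslit z hz)).congr_deriv ?_
    simp only [Pi.div_apply]
    field_simp
    ring
  refine eqOn_of_eventually_ofReal_eq isOpen_slitDisc isPreconnected_slitDisc hb
    (fun z hz => (differentiableAt_harmonicSum (hn z hz)).differentiableWithinAt)
    (g := fun y => 1 / 2 * Complex.log (y / (1 + y) / 16) * legendreSum y + singularIntegral y)
    (fun z hz => ((((hlog z hz).differentiableAt.const_mul _).mul (differentiableAt_legendreSum
      (hn z hz))).add (hI z hz.2).1.differentiableAt).differentiableWithinAt) ?_ hy
  have := eventually_eq_zero_of_legendre_ode
    (W := fun r => 1 / 2 * Complex.log (r / (1 + r) / 16) * legendreSum r + singularIntegral r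
      - harmonicSum r)
    (w := fun r => 1 / 2 * legendreSum r
      + 1 / 2 * Complex.log (r / (1 + r) / 16) * legendreSumDeriv r
      + r * (1 + r) * I' r - harmonicSumDeriv r)
    (fun y hy => ?_) (fun y hy => ?_) ?_
  · filter_upwards [this] with r hr using (sub_eq_zero.1 hr).symm
  · have h0 := ofReal_ne_zero_of_mem_Ioo hy
    have h1 := one_add_ofReal_ne_zero hy
    refine (((((hlog y (hb y hy)).const_mul (1 / 2)).mul (hasDerivAt_legendreSum
      (norm_ofReal_lt_one hy) h0)).add (hI y (hb y hy).2).1).sub (hasDerivAt_harmonicSum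
      (norm_ofReal_lt_one hy) h0)).comp_ofReal.congr_deriv ?_
    field_simp
  · have h0 := ofReal_ne_zero_of_mem_Ioo hy
    have h1 := one_add_ofReal_ne_zero hy
    refine (((((hasDerivAt_legendreSum (norm_ofReal_lt_one hy) h0).const_mul (1 / 2)).add
      (((hlog y (hb y hy)).const_mul (1 / 2)).mul (hasDerivAt_legendreSumDeriv
      (norm_ofReal_lt_one hy) h0))).add (hI y (hb y hy).2).2).sub (hasDerivAt_harmonicSumDeriv
      (norm_ofReal_lt_one hy) h0)).comp_ofReal.congr_deriv ?_
    field_simp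
    ring
  -- W is regrouped as (S + ½ log(r/16)) + ½ log(r/16)(A - 1) + (-½ log(1+r) A - G), each summand
  -- tending to 0.
  · have l1 := tendsto_singularIntegral_add_log
    have l2 := tendsto_log_mul_sub_one.const_mul (1 / 2)
    have l3 := tendsto_ofReal_of_continuousAt (f := fun y => -(1 / 2) * Complex.log (1 + y)
      * legendreSum y - harmonicSum y) (((continuousAt_const.mul ((by fun_prop :
        ContinuousAt (fun y : ℂ => 1 + y) 0).clog (by simp))).mul (differentiableAt_legendreSum
        (by simp)).continuousAt).sub (differentiableAt_harmonicSum (by simp)).continuousAt)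
    have l := (l1.add l2).add l3
    simp only [harmonicSum_zero, add_zero, Complex.log_one, mul_zero, zero_mul, sub_zero] at l
    refine l.congr' ?_
    filter_upwards [self_mem_nhdsWithin] with r hr
    have hr : 0 < r := hr
    have e : Complex.log (r / (1 + r) / 16) = Real.log (r / 16) - Complex.log (1 + r) := by
      rw [show (r / (1 + r) / 16 : ℂ) = ((r / 16 / (1 + r) : ℝ) : ℂ) by push_cast; ring,
        show (1 + r : ℂ) = ((1 + r : ℝ) : ℂ) by push_cast; ring, ← Complex.ofReal_log (by positivity),
        ← Complex.ofReal_log (by positivity), Real.log_div (by positivity) (by positivity)]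
      push_cast; rfl
    rw [e]
    ring

/-! ### Reduction of the elliptic integrals to quarter-period integrals, with principal branches. -/

theorem intervalIntegrable_and_integral_cos_subst (G : ℝ → ℂ) :
    (IntervalIntegrable (fun t => ((√(1 - t ^ 2))⁻¹ : ℝ) • G t) MeasureTheory.volume 0 1 ↔
      IntervalIntegrable (fun t => G (Real.cos t)) MeasureTheory.volume 0 (Real.pi / 2)) ∧
    ∫ t in (0 : ℝ)..1, ((√(1 - t ^ 2))⁻¹ : ℝ) • G t
      = ∫ t in (0 : ℝ)..(Real.pi / 2), G (Real.cos t) := by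
  have hπ := Real.pi_pos
  have himg : Real.cos '' Ioo 0 (Real.pi / 2) = Ioo 0 1 := by
    ext u
    constructor
    · rintro ⟨t, ht, rfl⟩
      refine ⟨Real.cos_pos_of_mem_Ioo ⟨by linarith [ht.1], ht.2⟩, ?_⟩
      have := Real.cos_lt_cos_of_nonneg_of_le_pi_div_two le_rfl ht.2.le ht.1
      rwa [Real.cos_zero] at this
    · intro hu
      exact ⟨Real.arccos u, ⟨Real.arccos_pos.2 hu.2, Real.arccos_lt_pi_div_two.2 hu.1⟩,
        Real.cos_arccos (by linarith [hu.1]) hu.2.le⟩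
  have hinj : InjOn Real.cos (Ioo 0 (Real.pi / 2)) :=
    Real.injOn_cos.mono (Ioo_subset_Icc_self.trans (Icc_subset_Icc_right (by linarith)))
  have hd : ∀ t ∈ Ioo 0 (Real.pi / 2),
      HasDerivWithinAt Real.cos (-Real.sin t) (Ioo 0 (Real.pi / 2)) t :=
    fun t _ => (Real.hasDerivAt_cos t).hasDerivWithinAt
  have hcongr : EqOn (fun t => |-Real.sin t| • (((√(1 - Real.cos t ^ 2))⁻¹ : ℝ) • G (Real.cos t)))
      (fun t => G (Real.cos t)) (Ioo 0 (Real.pi / 2)) := fun t ht => by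
    have hs : 0 < Real.sin t := Real.sin_pos_of_pos_of_lt_pi ht.1 (by linarith [ht.2])
    have h1 : 1 - Real.cos t ^ 2 = Real.sin t ^ 2 := by linarith [Real.sin_sq_add_cos_sq t]
    beta_reduce
    rw [h1, Real.sqrt_sq hs.le, abs_neg, abs_of_pos hs, smul_smul, mul_inv_cancel₀ hs.ne', one_smul]
  constructor
  · rw [intervalIntegrable_iff_integrableOn_Ioo_of_le zero_le_one,
      intervalIntegrable_iff_integrableOn_Ioo_of_le (by positivity), ← himg,
      MeasureTheory.integrableOn_image_iff_integrableOn_abs_deriv_smul measurableSet_Ioo hd hinj]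
    exact MeasureTheory.integrableOn_congr_fun hcongr measurableSet_Ioo
  · rw [intervalIntegral.integral_of_le zero_le_one, MeasureTheory.integral_Ioc_eq_integral_Ioo,
      intervalIntegral.integral_of_le (by positivity), MeasureTheory.integral_Ioc_eq_integral_Ioo,
      ← himg, MeasureTheory.integral_image_eq_integral_abs_deriv_smul measurableSet_Ioo hd hinj]
    exact MeasureTheory.setIntegral_congr_fun measurableSet_Ioo hcongr

theorem Complex.sqrt_div_of_arg_sub_mem {z w : ℂ} (hw : w ≠ 0)
    (h : z.arg - w.arg ∈ Ioc (-Real.pi) Real.pi) :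
    Complex.sqrt (z / w) = Complex.sqrt z / Complex.sqrt w := by
  rcases eq_or_ne z 0 with rfl | hz
  · simp
  have hlog : Complex.log (z / w) = Complex.log z - Complex.log w := by
    have e : z / w = Complex.exp (Complex.log z - Complex.log w) := by
      rw [Complex.exp_sub, Complex.exp_log hz, Complex.exp_log hw]
    rw [e, Complex.log_exp]
    · simpa [Complex.log_im] using h.1
    · simpa [Complex.log_im] using h.2
  simp only [Complex.sqrt]
  rw [Complex.cpow_def_of_ne_zero hz, Complex.cpow_def_of_ne_zero hw,
    Complex.cpow_def_of_ne_zero (div_ne_zero hz hw), hlog, ← Complex.exp_sub]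
  ring_nf

theorem one_div_sqrt_eq_cpow (z : ℂ) : 1 / Complex.sqrt z = z ^ (-1 / 2 : ℂ) := by
  rw [Complex.sqrt, one_div, ← Complex.cpow_neg]
  norm_num

theorem sqrt_ofReal_of_nonneg {r : ℝ} (hr : 0 ≤ r) : Complex.sqrt r = (√r : ℝ) := by
  rw [Complex.sqrt_of_nonneg (by exact_mod_cast hr), Complex.ofReal_re]

theorem complexEllipticIntegrand_eq {k : ℂ} {t : ℝ} (ht : t ∈ Ioo (0 : ℝ) 1) :
    complexEllipticIntegrand k t
      = ((√(1 - t ^ 2))⁻¹ : ℝ) • (1 / Complex.sqrt (1 - k ^ 2 * (t : ℂ) ^ 2)) := by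
  have h1 : 0 < 1 - t ^ 2 := by nlinarith [ht.1, ht.2]
  have h2 : ((1 - t ^ 2 : ℝ) : ℂ) ≠ 0 := by exact_mod_cast h1.ne'
  -- The positive factor is written as a divisor of argument 0, so the quotient rule for principal
  -- roots applies to every k.
  have e : (1 - (t : ℂ) ^ 2) * (1 - k ^ 2 * (t : ℂ) ^ 2)
      = (1 - k ^ 2 * (t : ℂ) ^ 2) / (((1 - t ^ 2)⁻¹ : ℝ) : ℂ) := by
    push_cast at h2 ⊢
    rw [div_inv_eq_mul]; ring
  rw [complexEllipticIntegrand, e, Complex.sqrt_div_of_arg_sub_mem]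
  · have : Complex.sqrt (((1 - t ^ 2)⁻¹ : ℝ) : ℂ) = ((√(1 - t ^ 2))⁻¹ : ℝ) := by
      rw [sqrt_ofReal_of_nonneg (inv_pos.2 h1).le, Real.sqrt_inv]
    rw [this, Complex.real_smul, one_div_div]
    ring
  · exact_mod_cast (inv_pos.2 h1).ne'
  · rw [Complex.arg_ofReal_of_nonneg (inv_pos.2 h1).le, sub_zero]
    exact Complex.arg_mem_Ioc _

theorem complexElliptic_subst (k : ℂ) :
    (IntervalIntegrable (complexEllipticIntegrand k) MeasureTheory.volume 0 1 ↔
      IntervalIntegrable (fun t : ℝ => 1 / Complex.sqrt (1 - k ^ 2 * (Real.cos t : ℂ) ^ 2))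
        MeasureTheory.volume 0 (Real.pi / 2)) ∧
    complexEllipticK k
      = ∫ t in (0 : ℝ)..(Real.pi / 2), 1 / Complex.sqrt (1 - k ^ 2 * (Real.cos t : ℂ) ^ 2) := by
  obtain ⟨h1, h2⟩ := intervalIntegrable_and_integral_cos_subst
    fun t : ℝ => 1 / Complex.sqrt (1 - k ^ 2 * (t : ℂ) ^ 2)
  refine ⟨?_, ?_⟩
  · rw [← h1, intervalIntegrable_iff_integrableOn_Ioo_of_le zero_le_one,
      intervalIntegrable_iff_integrableOn_Ioo_of_le zero_le_one]
    exact MeasureTheory.integrableOn_congr_fun (fun t ht => complexEllipticIntegrand_eq ht)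
      measurableSet_Ioo
  · rw [← h2, complexEllipticK, intervalIntegral.integral_of_le zero_le_one,
      MeasureTheory.integral_Ioc_eq_integral_Ioo, intervalIntegral.integral_of_le zero_le_one,
      MeasureTheory.integral_Ioc_eq_integral_Ioo]
    exact MeasureTheory.setIntegral_congr_fun measurableSet_Ioo
      fun t ht => complexEllipticIntegrand_eq ht

theorem Complex.sq_sqrt (z : ℂ) : Complex.sqrt z ^ 2 = z := by
  rw [Complex.sqrt]
  exact_mod_cast Complex.cpow_nat_inv_pow z two_ne_zero

theorem re_one_add_pos {y : ℂ} (hy : ‖y‖ < 1) : 0 < (1 + y).re := by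
  have := neg_lt_of_abs_lt ((Complex.abs_re_le_norm y).trans_lt hy)
  simp only [Complex.add_re, Complex.one_re]
  linarith

theorem ofReal_cos_sq (t : ℝ) : (Real.cos t : ℂ) ^ 2 = 1 - ((Real.sin t ^ 2 : ℝ) : ℂ) := by
  rw [← Complex.ofReal_pow, Real.cos_sq']; push_cast; ring

/-- With k² = y/(1+y), 1 - k² cos² t = (1 + y sin² t)/(1+y). Numerator and denominator lie in the
right half plane, so their arguments differ by less than π. -/
theorem one_div_sqrt_regular {y : ℂ} (hy : ‖y‖ < 1) (t : ℝ) :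
    1 / Complex.sqrt (1 - Complex.sqrt (y / (1 + y)) ^ 2 * (Real.cos t : ℂ) ^ 2)
      = Complex.sqrt (1 + y) * (((1 : ℝ) : ℂ) + (Real.sin t ^ 2 : ℝ) * y) ^ (-1 / 2 : ℂ) := by
  have h1 := one_add_ne_zero_of_norm_lt hy
  have e : 1 - Complex.sqrt (y / (1 + y)) ^ 2 * (Real.cos t : ℂ) ^ 2
      = (((1 : ℝ) : ℂ) + (Real.sin t ^ 2 : ℝ) * y) / (1 + y) := by
    rw [Complex.sq_sqrt, ofReal_cos_sq, Complex.ofReal_one]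
    field_simp
    ring
  have hn : ‖((Real.sin t ^ 2 : ℝ) : ℂ) * y‖ < 1 := by
    rw [norm_mul, Complex.norm_real, Real.norm_of_nonneg (by positivity)]
    nlinarith [norm_nonneg y, Real.sin_sq_le_one t]
  have a1 := abs_lt.1 (Complex.abs_arg_lt_pi_div_two_iff.2 (.inl (re_one_add_pos hy)))
  have a2 := abs_lt.1 (Complex.abs_arg_lt_pi_div_two_iff.2 (.inl (re_one_add_pos hn)))
  rw [e, Complex.sqrt_div_of_arg_sub_mem h1, one_div_div, ← one_div_sqrt_eq_cpow, mul_one_div]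
  rw [Complex.ofReal_one]
  exact ⟨by linarith, by linarith⟩

/-- Here the quotient is (sin² t + y)/(1+y), whose numerator may leave the right half plane. It has
the same imaginary part as 1 + y, so both arguments lie on the same side of 0 and their difference
stays in (-π, π]; the value π does occur for negative y. -/
theorem one_div_sqrt_singular {y : ℂ} (hy : ‖y‖ < 1) (t : ℝ) :
    1 / Complex.sqrt (1 - (1 / Complex.sqrt (1 + y)) ^ 2 * (Real.cos t : ℂ) ^ 2)
      = Complex.sqrt (1 + y) * ((Real.sin t ^ 2 : ℝ) + ((1 : ℝ) : ℂ) * y) ^ (-1 / 2 : ℂ) := by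
  have h1 := one_add_ne_zero_of_norm_lt hy
  have e : 1 - (1 / Complex.sqrt (1 + y)) ^ 2 * (Real.cos t : ℂ) ^ 2
      = ((Real.sin t ^ 2 : ℝ) + ((1 : ℝ) : ℂ) * y) / (1 + y) := by
    rw [div_pow, Complex.sq_sqrt, ofReal_cos_sq, Complex.ofReal_one]
    field_simp
    ring
  have a1 := abs_lt.1 (Complex.abs_arg_lt_pi_div_two_iff.2 (.inl (re_one_add_pos hy)))
  rw [e, Complex.sqrt_div_of_arg_sub_mem h1, one_div_div, ← one_div_sqrt_eq_cpow, mul_one_div]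
  rw [Complex.ofReal_one, one_mul]
  set z : ℂ := (Real.sin t ^ 2 : ℝ) + y with hz
  have hzim : z.im = y.im := by rw [hz, Complex.add_im, Complex.ofReal_im, zero_add]
  have hwim : (1 + y).im = y.im := by simp
  have b1 := Complex.neg_pi_lt_arg z
  have b2 := Complex.arg_le_pi z
  rcases le_or_gt 0 y.im with h | h
  · have c1 := Complex.arg_nonneg_iff.2 (hzim.symm ▸ h)
    have c2 := Complex.arg_nonneg_iff.2 (hwim.symm ▸ h)
    exact ⟨by linarith, by linarith⟩
  · have c1 := Complex.arg_neg_iff.2 (hzim.symm ▸ h)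
    have c2 := Complex.arg_neg_iff.2 (hwim.symm ▸ h)
    exact ⟨by linarith, by linarith⟩

theorem intervalIntegrable_regular {y : ℂ} (hy : ‖y‖ < 1) :
    IntervalIntegrable (complexEllipticIntegrand (Complex.sqrt (y / (1 + y))))
      MeasureTheory.volume 0 1 := by
  rw [(complexElliptic_subst _).1]
  simp only [one_div_sqrt_regular hy]
  refine IntervalIntegrable.const_mul (ContinuousOn.intervalIntegrable ?_) _
  refine ContinuousOn.cpow (Continuous.continuousOn (by fun_prop)) continuousOn_const fun t _ => ?_
  rw [Complex.ofReal_one]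
  exact one_add_mul_mem_slitPlane hy (by positivity) (Real.sin_sq_le_one t)

theorem complexEllipticK_regular {y : ℂ} (hy : ‖y‖ < 1) :
    complexEllipticK (Complex.sqrt (y / (1 + y)))
      = Complex.sqrt (1 + y) * regularIntegral y := by
  rw [(complexElliptic_subst _).2]
  simp only [one_div_sqrt_regular hy]
  rw [intervalIntegral.integral_const_mul]
  rfl

theorem complexEllipticK_singular {y : ℂ} (hy : ‖y‖ < 1) :
    complexEllipticK (1 / Complex.sqrt (1 + y))
      = Complex.sqrt (1 + y) * singularIntegral y := by
  rw [(complexElliptic_subst _).2]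
  simp only [one_div_sqrt_singular hy]
  rw [intervalIntegral.integral_const_mul]
  rfl

/-! ### The negative real axis: integrability and the limit from above. -/

/-- With sin² θ₀ = -y, sin² t + y = sin(t + θ₀) sin(t - θ₀). The first factor is bounded below on
[0, π/2] and the second by Jordan's inequality, so only an integrable |t - θ₀|^(-1/2) singularity
remains. Since |w| ≥ |Re w|, the bound is uniform on the line Re z = y, which makes it a dominating
function for the vertical approach. -/
theorem exists_norm_singularIntegrand_le {y : ℝ} (hy : y ∈ Ioo (-1 : ℝ) 0) :
    ∃ C θ₀ : ℝ, ∀ z : ℂ, z.re = y → ∀ t ∈ Icc 0 (Real.pi / 2), t ≠ θ₀ →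
      Real.sin t ^ 2 + y ≠ 0 ∧
      ‖((Real.sin t ^ 2 : ℝ) + ((1 : ℝ) : ℂ) * z) ^ (-1 / 2 : ℂ)‖
        ≤ C * ‖((t - θ₀ : ℝ) : ℂ) ^ (-1 / 2 : ℂ)‖ := by
  have hπ := Real.pi_pos
  set θ₀ := Real.arcsin √(-y) with hθ
  have hsq0 : 0 < √(-y) := Real.sqrt_pos.2 (by linarith [hy.2])
  have hsq1 : √(-y) < 1 := by rw [Real.sqrt_lt' one_pos]; linarith [hy.1]
  have h0 : 0 < θ₀ := Real.arcsin_pos.2 hsq0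
  have h1 : θ₀ < Real.pi / 2 := Real.arcsin_lt_pi_div_two.2 hsq1
  have hsin : Real.sin θ₀ ^ 2 = -y := by
    rw [hθ, Real.sin_arcsin (by linarith) hsq1.le, Real.sq_sqrt (by linarith [hy.2])]
  obtain ⟨t₁, ht₁, hmin⟩ := (isCompact_Icc (a := (0 : ℝ)) (b := Real.pi / 2)).exists_isMinOn
    ⟨0, by constructor <;> linarith⟩ (f := fun t => Real.sin (t + θ₀)) (by fun_prop)
  set m := Real.sin (t₁ + θ₀) with hm
  have hm0 : 0 < m := Real.sin_pos_of_pos_of_lt_pi (by linarith [ht₁.1]) (by linarith [ht₁.2])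
  have hc : 0 < m * (2 / Real.pi) := by positivity
  have norm_half : ∀ z : ℂ, ‖z ^ (-1 / 2 : ℂ)‖ = ‖z‖ ^ (-1 / 2 : ℝ) := fun z => by
    rw [← Complex.norm_cpow_real]; norm_num
  refine ⟨(m * (2 / Real.pi)) ^ (-1 / 2 : ℝ), θ₀, fun z hz t ht htθ => ?_⟩
  have hlow : m * (2 / Real.pi) * |t - θ₀| ≤ |Real.sin t ^ 2 + y| := by
    have e : Real.sin t ^ 2 + y = Real.sin (t + θ₀) * Real.sin (t - θ₀) := by
      have h3 := Real.sin_sq_add_cos_sq t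
      have h4 := Real.sin_sq_add_cos_sq θ₀
      rw [Real.sin_add, Real.sin_sub, ← neg_eq_iff_eq_neg.2 hsin]
      linear_combination Real.sin t ^ 2 * (-h4) + Real.sin θ₀ ^ 2 * h3
    have h5 : |t - θ₀| ≤ Real.pi / 2 := abs_le.2 ⟨by linarith [ht.1], by linarith [ht.2]⟩
    have h6 := Real.mul_abs_le_abs_sin h5
    have h7 : m ≤ |Real.sin (t + θ₀)| := (hmin ht).trans (le_abs_self _)
    rw [e, abs_mul, mul_assoc]
    exact mul_le_mul h7 h6 (by positivity) (by positivity)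
  have hpos : 0 < |t - θ₀| := abs_pos.2 (sub_ne_zero.2 htθ)
  have hpos2 : 0 < |Real.sin t ^ 2 + y| := lt_of_lt_of_le (by positivity) hlow
  refine ⟨abs_pos.1 hpos2, ?_⟩
  rw [norm_half, norm_half, Complex.norm_real, Real.norm_eq_abs,
    ← Real.mul_rpow hc.le (abs_nonneg _)]
  refine Real.rpow_le_rpow_of_nonpos (by positivity) (hlow.trans ?_) (by norm_num)
  refine le_trans (le_of_eq ?_) (Complex.abs_re_le_norm _)
  rw [Complex.ofReal_one, one_mul, Complex.add_re, Complex.ofReal_re, hz]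

theorem intervalIntegrable_norm_cpow_neg_half (θ₀ a b : ℝ) :
    IntervalIntegrable (fun t : ℝ => ‖((t - θ₀ : ℝ) : ℂ) ^ (-1 / 2 : ℂ)‖)
      MeasureTheory.volume a b := by
  have h := (intervalIntegral.intervalIntegrable_cpow' (r := (-1 / 2 : ℂ)) (a := a - θ₀)
    (b := b - θ₀) (by norm_num)).norm.comp_sub_right θ₀
  simpa using h

theorem measurable_singularIntegrand (z : ℂ) :
    Measurable fun t : ℝ => ((Real.sin t ^ 2 : ℝ) + ((1 : ℝ) : ℂ) * z) ^ (-1 / 2 : ℂ) := by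
  fun_prop

theorem ae_ne_of_mem_Icc {p : ℝ → Prop} {θ₀ : ℝ}
    (h : ∀ t ∈ Icc 0 (Real.pi / 2), t ≠ θ₀ → p t) :
    ∀ᵐ t : ℝ, t ∈ uIoc 0 (Real.pi / 2) → p t := by
  filter_upwards [MeasureTheory.Measure.ae_ne MeasureTheory.volume θ₀] with t ht hmem
  rw [uIoc_of_le (by positivity)] at hmem
  exact h t (Ioc_subset_Icc_self hmem) ht

theorem intervalIntegrable_singularIntegrand_of_neg {y : ℝ} (hy : y ∈ Ioo (-1 : ℝ) 0) :
    IntervalIntegrable (fun t : ℝ => ((Real.sin t ^ 2 : ℝ) + ((1 : ℝ) : ℂ) * y) ^ (-1 / 2 : ℂ))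
      MeasureTheory.volume 0 (Real.pi / 2) := by
  obtain ⟨C, θ₀, h⟩ := exists_norm_singularIntegrand_le hy
  refine ((intervalIntegrable_norm_cpow_neg_half θ₀ 0 (Real.pi / 2)).const_mul C).mono_fun'
    (measurable_singularIntegrand y).aestronglyMeasurable ?_
  rw [Filter.EventuallyLE, MeasureTheory.ae_restrict_iff' measurableSet_uIoc]
  exact ae_ne_of_mem_Icc fun t ht htθ => (h y (by simp) t ht htθ).2

theorem exists_ofReal_of_notMem_slitPlane {y : ℂ} (hy : ‖y‖ < 1) (h0 : y ≠ 0)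
    (hs : y ∉ Complex.slitPlane) : ∃ r : ℝ, y = r ∧ r ∈ Ioo (-1 : ℝ) 0 := by
  rw [Complex.mem_slitPlane_iff, not_or, not_lt, not_not] at hs
  have e : y = (y.re : ℂ) := Complex.ext rfl (by simpa using hs.2)
  refine ⟨y.re, e, ?_, lt_of_le_of_ne hs.1 fun h => h0 (by rw [e, h, Complex.ofReal_zero])⟩
  exact neg_lt_of_abs_lt ((Complex.abs_re_le_norm y).trans_lt hy)

theorem intervalIntegrable_singular {y : ℂ} (hy : ‖y‖ < 1) (h0 : y ≠ 0) :
    IntervalIntegrable (complexEllipticIntegrand (1 / Complex.sqrt (1 + y)))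
      MeasureTheory.volume 0 1 := by
  rw [(complexElliptic_subst _).1]
  simp only [one_div_sqrt_singular hy]
  refine IntervalIntegrable.const_mul ?_ _
  by_cases hs : y ∈ Complex.slitPlane
  · refine (ContinuousOn.cpow (Continuous.continuousOn (by fun_prop)) continuousOn_const
      fun t _ => ?_).intervalIntegrable
    rw [Complex.ofReal_one, one_mul]
    exact ofReal_add_mem_slitPlane hs (by positivity)
  · obtain ⟨r, rfl, hr⟩ := exists_ofReal_of_notMem_slitPlane hy h0 hs
    exact intervalIntegrable_singularIntegrand_of_neg hr

/-- The argument on the negative axis is π, so the principal logarithm is continuous there from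
above, though not from below. -/
theorem tendsto_log_add_mul_I {x : ℝ} (hx : x ≠ 0) :
    Tendsto (fun ε : ℝ => Complex.log (x + ε * Complex.I)) (𝓝[>] 0) (𝓝 (Complex.log x)) := by
  have hc : Continuous fun ε : ℝ => (x + ε * Complex.I : ℂ) := by fun_prop
  have ht : Tendsto (fun ε : ℝ => (x + ε * Complex.I : ℂ)) (𝓝[>] 0) (𝓝[{z | 0 ≤ z.im}] (x : ℂ)) := by
    refine tendsto_nhdsWithin_of_tendsto_nhds_of_eventually_within _ ?_ ?_
    · simpa using (hc.tendsto 0).mono_left nhdsWithin_le_nhds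
    · filter_upwards [self_mem_nhdsWithin] with ε hε
      simpa using le_of_lt hε
  rcases hx.lt_or_gt with h | h
  · exact (Complex.continuousWithinAt_log_of_re_neg_of_im_zero (by simpa) (by simp)).tendsto.comp ht
  · exact (continuousAt_clog (Complex.ofReal_mem_slitPlane.2 h)).tendsto.comp
      (ht.mono_right nhdsWithin_le_nhds)

theorem tendsto_singularIntegral_of_neg {y : ℝ} (hy : y ∈ Ioo (-1 : ℝ) 0) :
    Tendsto (fun ε : ℝ => singularIntegral (y + ε * Complex.I)) (𝓝[>] 0)
      (𝓝 (singularIntegral y)) := by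
  obtain ⟨C, θ₀, h⟩ := exists_norm_singularIntegrand_le hy
  refine intervalIntegral.tendsto_integral_filter_of_dominated_convergence
    (fun t => C * ‖((t - θ₀ : ℝ) : ℂ) ^ (-1 / 2 : ℂ)‖) ?_ ?_ ?_ ?_
  · exact .of_forall fun ε => (measurable_singularIntegrand _).aestronglyMeasurable
  · exact .of_forall fun ε => ae_ne_of_mem_Icc fun t ht htθ => (h _ (by simp) t ht htθ).2
  · exact (intervalIntegrable_norm_cpow_neg_half θ₀ 0 (Real.pi / 2)).const_mul C
  · refine ae_ne_of_mem_Icc (θ₀ := θ₀) fun t ht htθ => ?_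
    have hne := (h y (by simp) t ht htθ).1
    have hlim := ((tendsto_log_add_mul_I hne).mul_const (-1 / 2 : ℂ)).cexp
    rw [← Complex.cpow_def_of_ne_zero (by exact_mod_cast hne)] at hlim
    have e0 : ((Real.sin t ^ 2 + y : ℝ) : ℂ) = (Real.sin t ^ 2 : ℝ) + ((1 : ℝ) : ℂ) * y := by
      push_cast; ring
    rw [e0] at hlim
    refine hlim.congr' ?_
    filter_upwards [self_mem_nhdsWithin] with ε hε
    have e : ((Real.sin t ^ 2 : ℝ) + ((1 : ℝ) : ℂ) * y + ε * Complex.I : ℂ)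
      = (Real.sin t ^ 2 : ℝ) + ((1 : ℝ) : ℂ) * (y + ε * Complex.I) := by push_cast; ring
    rw [e, ← Complex.cpow_def_of_ne_zero]
    intro h0
    have := congrArg Complex.im h0
    rw [Complex.ofReal_one, one_mul] at this
    simp only [Complex.add_im, Complex.ofReal_im, Complex.mul_im, Complex.ofReal_re,
      Complex.I_im, Complex.I_re, Complex.zero_im, zero_add, mul_one, mul_zero, add_zero] at this
    exact (ne_of_gt hε) this

theorem harmonicSum_eq {y : ℂ} (hy : ‖y‖ < 1) (h0 : y ≠ 0) :
    harmonicSum y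
      = 1 / 2 * Complex.log (y / (1 + y) / 16) * legendreSum y + singularIntegral y := by
  by_cases hs : y ∈ Complex.slitPlane
  · exact harmonicSum_eq_of_mem_slitDisc ⟨by simpa using hy, hs⟩
  obtain ⟨r, rfl, hr⟩ := exists_ofReal_of_notMem_slitPlane hy h0 hs
  have hc : Continuous fun ε : ℝ => (r + ε * Complex.I : ℂ) := by fun_prop
  have ht : Tendsto (fun ε : ℝ => (r + ε * Complex.I : ℂ)) (𝓝[>] 0) (𝓝 r) := by
    simpa using (hc.tendsto 0).mono_left nhdsWithin_le_nhds
  have hpos : ∀ ε : ℝ, 0 < ε → 0 < (r + ε * Complex.I : ℂ).im := fun ε hε => by simpa using hε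
  have hnorm : ∀ᶠ ε : ℝ in 𝓝[>] 0, ‖(r + ε * Complex.I : ℂ)‖ < 1 :=
    ht.norm.eventually_lt_const hy
  -- The argument of the logarithm also reaches the cut from above, since y/(1+y) keeps the sign of
  -- the imaginary part.
  have hlog : Tendsto (fun ε : ℝ => Complex.log ((r + ε * Complex.I) / (1 + (r + ε * Complex.I))
      / 16)) (𝓝[>] 0) (𝓝 (Complex.log (r / (1 + r) / 16))) := by
    have e : (r / (1 + r) / 16 : ℂ) = ((r / (1 + r) / 16 : ℝ) : ℂ) := by push_cast; rfl
    have hneg : r / (1 + r) / 16 < 0 :=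
      div_neg_of_neg_of_pos (div_neg_of_neg_of_pos hr.2 (by linarith [hr.1])) (by norm_num)
    have hcw := Complex.continuousWithinAt_log_of_re_neg_of_im_zero
      (z := (r / (1 + r) / 16 : ℂ)) (by rw [e]; exact hneg) (by rw [e]; exact Complex.ofReal_im _)
    refine hcw.tendsto.comp (tendsto_nhdsWithin_of_tendsto_nhds_of_eventually_within _ ?_ ?_)
    · exact (ht.div (ht.const_add 1) (one_add_ne_zero_of_norm_lt hy)).div_const 16
    · filter_upwards [self_mem_nhdsWithin] with ε hε
      rw [show (16 : ℂ) = ((16 : ℝ) : ℂ) by norm_num, Complex.div_ofReal_im,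
        div_one_add_im]
      exact div_nonneg (div_nonneg (hpos ε hε).le (Complex.normSq_nonneg _)) (by norm_num)
  have l1 := (differentiableAt_harmonicSum hy).continuousAt.tendsto.comp ht
  have l2 := ((hlog.const_mul (1 / 2)).mul
    ((differentiableAt_legendreSum hy).continuousAt.tendsto.comp ht)).add
    (tendsto_singularIntegral_of_neg hr)
  refine tendsto_nhds_unique (l1.congr' ?_) l2
  filter_upwards [hnorm, self_mem_nhdsWithin] with ε hε hε0
  exact harmonicSum_eq_of_mem_slitDisc ⟨by simpa using hε,
    Complex.mem_slitPlane_iff.2 (.inr (hpos ε hε0).ne')⟩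

/-! ### Return to the variable x = y/16 and to real arguments. -/

theorem harmonicTerm_eq (x : ℂ) (n : ℕ) :
    harmonicTerm x n = legendreCoeff n * (harmonic n : ℚ) * (16 * x) ^ n := by
  rw [harmonicTerm, legendreCoeff, Nat.centralBinom, mul_pow, div_pow, ← pow_mul, mul_comm n 2,
    pow_mul, show (4 : ℂ) ^ 2 = 16 by norm_num]
  field_simp

theorem harmonicF_eq (x : ℂ) : harmonicF x = harmonicSum (16 * x) :=
  tsum_congr fun n => harmonicTerm_eq x n

theorem summable_harmonicTerm {x : ℂ} (hx : ‖16 * x‖ < 1) : Summable (harmonicTerm x) :=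
  (summable_mul_pow (k := 1) (by simpa using norm_natCast_pow_mul_legendreCoeff_harmonic_le 0)
    hx).congr fun n => (harmonicTerm_eq x n).symm

theorem harmonicF_eq_complexClosedForm {x : ℂ} (hx : ‖16 * x‖ < 1) (h0 : 16 * x ≠ 0) :
    harmonicF x = complexClosedForm x := by
  have hπ : (Real.pi : ℂ) ≠ 0 := by exact_mod_cast Real.pi_ne_zero
  have hs : Complex.sqrt (1 + 16 * x) ≠ 0 := fun h => one_add_ne_zero_of_norm_lt hx <| by
    rw [← Complex.sq_sqrt (1 + 16 * x), h]; simp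
  rw [harmonicF_eq, harmonicSum_eq hx h0, complexClosedForm, complexEllipticK_regular hx,
    complexEllipticK_singular hx, regularIntegral_eq hx,
    show 16 * x / (1 + 16 * x) / 16 = x / (1 + 16 * x) by ring]
  generalize Complex.sqrt (1 + 16 * x) = s at hs ⊢
  field_simp

/-- For k² ≤ 1 the radicand is nonnegative, so the principal root is the real one; where it
vanishes, both integrands are 0 by convention. -/
theorem complexEllipticIntegrand_ofReal {k t : ℝ} (hk : k ^ 2 ≤ 1) (ht : t ∈ Ioc (0 : ℝ) 1) :
    complexEllipticIntegrand k t = (ellipticIntegrand k t : ℂ) := by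
  have h1 : t ^ 2 ≤ 1 := pow_le_one₀ ht.1.le ht.2
  have h2 : 0 ≤ (1 - t ^ 2) * (1 - k ^ 2 * t ^ 2) :=
    mul_nonneg (by linarith) (by nlinarith [sq_nonneg t])
  rw [complexEllipticIntegrand, one_div_sqrt_eq_cpow, ellipticIntegrand, one_div,
    ← ofReal_cpow_neg_half h2]
  push_cast
  rfl

theorem complexEllipticK_ofReal {k : ℝ} (hk : k ^ 2 ≤ 1) :
    complexEllipticK k = (ellipticK k : ℂ) := by
  rw [complexEllipticK, ellipticK, ← intervalIntegral.integral_ofReal]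
  refine intervalIntegral.integral_congr_ae (.of_forall fun t ht => ?_)
  rw [uIoc_of_le zero_le_one] at ht
  exact complexEllipticIntegrand_ofReal hk ht

theorem intervalIntegrable_ellipticIntegrand {k : ℝ} (hk : k ^ 2 ≤ 1)
    (h : IntervalIntegrable (complexEllipticIntegrand k) MeasureTheory.volume 0 1) :
    IntervalIntegrable (ellipticIntegrand k) MeasureTheory.volume 0 1 := by
  rw [intervalIntegrable_iff_integrableOn_Ioc_of_le zero_le_one] at h ⊢
  have h2 : MeasureTheory.IntegrableOn (fun t => (ellipticIntegrand k t : ℂ)) (Ioc 0 1) :=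
    (MeasureTheory.integrableOn_congr_fun (fun t ht => complexEllipticIntegrand_ofReal hk ht)
      measurableSet_Ioc).1 h
  exact h2.re

theorem harmonicTerm_ofReal (x : ℝ) (n : ℕ) :
    harmonicTerm (x : ℂ) n = ((harmonicTerm x n : ℝ) : ℂ) := by
  simp [harmonicTerm]

theorem mainTheorem2 :
    (∀ x : ℝ, 0 < x → x < 1 / 16 →
      Summable (harmonicTerm x) ∧
      IntervalIntegrable (ellipticIntegrand (√(16 * x / (1 + 16 * x))))
        MeasureTheory.volume 0 1 ∧
      IntervalIntegrable (ellipticIntegrand (1 / √(1 + 16 * x)))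
        MeasureTheory.volume 0 1 ∧
      harmonicF x = closedForm x) ∧
    (∀ x : ℂ, x ≠ 0 → ‖x‖ < 1 / 16 →
      Summable (harmonicTerm x) ∧
      IntervalIntegrable (complexEllipticIntegrand (Complex.sqrt (16 * x / (1 + 16 * x))))
        MeasureTheory.volume 0 1 ∧
      IntervalIntegrable (complexEllipticIntegrand (1 / Complex.sqrt (1 + 16 * x)))
        MeasureTheory.volume 0 1 ∧
      harmonicF x = complexClosedForm x) ∧
    (Summable (harmonicTerm (0 : ℂ)) ∧ harmonicF (0 : ℂ) = 0 ∧
      Filter.Tendsto complexClosedForm (nhdsWithin 0 {0}ᶜ) (nhds (harmonicF (0 : ℂ)))) := by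
  have hnorm : ∀ x : ℂ, ‖x‖ < 1 / 16 → ‖16 * x‖ < 1 := fun x hx => by
    rw [norm_mul, Complex.norm_ofNat]; linarith
  have hne : ∀ x : ℂ, x ≠ 0 → 16 * x ≠ 0 := fun x hx => mul_ne_zero (by norm_num) hx
  have hcomplex : ∀ x : ℂ, x ≠ 0 → ‖x‖ < 1 / 16 →
      Summable (harmonicTerm x) ∧
      IntervalIntegrable (complexEllipticIntegrand (Complex.sqrt (16 * x / (1 + 16 * x))))
        MeasureTheory.volume 0 1 ∧
      IntervalIntegrable (complexEllipticIntegrand (1 / Complex.sqrt (1 + 16 * x)))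
        MeasureTheory.volume 0 1 ∧
      harmonicF x = complexClosedForm x := fun x h0 hx =>
    ⟨summable_harmonicTerm (hnorm x hx), intervalIntegrable_regular (hnorm x hx),
      intervalIntegrable_singular (hnorm x hx) (hne x h0),
      harmonicF_eq_complexClosedForm (hnorm x hx) (hne x h0)⟩
  refine ⟨fun x h0 hx => ?_, hcomplex, ?_, ?_, ?_⟩
  · obtain ⟨hS, hI₁, hI₂, hF⟩ := hcomplex x (by exact_mod_cast h0.ne')
      (by rwa [Complex.norm_real, Real.norm_of_nonneg h0.le])
    have hpos : 0 < 1 + 16 * x := by positivity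
    have e₁ : Complex.sqrt (16 * x / (1 + 16 * x)) = (√(16 * x / (1 + 16 * x)) : ℝ) := by
      rw [← sqrt_ofReal_of_nonneg (by positivity)]; push_cast; rfl
    have e₂ : Complex.sqrt (1 + 16 * x) = (√(1 + 16 * x) : ℝ) := by
      rw [← sqrt_ofReal_of_nonneg hpos.le]; push_cast; rfl
    have e₃ : 1 / Complex.sqrt (1 + 16 * x) = ((1 / √(1 + 16 * x) : ℝ) : ℂ) := by
      rw [e₂]; push_cast; rfl
    have e₄ : Complex.log (x / (1 + 16 * x)) = (Real.log (x / (1 + 16 * x)) : ℝ) := by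
      rw [Complex.ofReal_log (by positivity)]; push_cast; rfl
    have k₁ : √(16 * x / (1 + 16 * x)) ^ 2 ≤ 1 := by
      rw [Real.sq_sqrt (by positivity)]
      exact div_le_one_of_le₀ (by linarith) hpos.le
    have k₂ : (1 / √(1 + 16 * x)) ^ 2 ≤ 1 := by
      rw [div_pow, Real.sq_sqrt hpos.le, one_pow]
      exact div_le_one_of_le₀ (by linarith) hpos.le
    rw [e₁] at hI₁
    rw [e₃] at hI₂
    refine ⟨Complex.summable_ofReal.1 ((summable_congr (harmonicTerm_ofReal x)).1 hS),
      intervalIntegrable_ellipticIntegrand k₁ hI₁,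
      intervalIntegrable_ellipticIntegrand k₂ hI₂, ?_⟩
    apply Complex.ofReal_injective
    have hF' : harmonicF (x : ℂ) = ((harmonicF x : ℝ) : ℂ) := by
      rw [harmonicF, harmonicF, Complex.ofReal_tsum]
      exact tsum_congr (harmonicTerm_ofReal x)
    rw [← hF', hF, complexClosedForm, closedForm, e₁, e₃, e₄, e₂, complexEllipticK_ofReal k₁,
      complexEllipticK_ofReal k₂]
    push_cast
    rfl
  · exact summable_harmonicTerm (by simp)
  · rw [harmonicF_eq, mul_zero, harmonicSum_zero]
  -- Near 0 but off it the closed form equals the power series, so its limit follows from continuity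
  -- of the series alone.
  · have hc : ContinuousAt (fun x : ℂ => harmonicSum (16 * x)) 0 :=
      ContinuousAt.comp (g := harmonicSum) (f := fun x : ℂ => 16 * x)
        (by simpa using (differentiableAt_harmonicSum (y := 0) (by simp)).continuousAt)
        (by fun_prop)
    rw [harmonicF_eq]
    refine (hc.tendsto.mono_left nhdsWithin_le_nhds).congr' ?_
    filter_upwards [self_mem_nhdsWithin,
      mem_nhdsWithin_of_mem_nhds (Metric.ball_mem_nhds (0 : ℂ) (by norm_num : (0 : ℝ) < 1 / 16))]
      with x hx0 hx
    rw [← harmonicF_eq]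
    exact (hcomplex x hx0 (by simpa using hx)).2.2.2

end
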